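/- Let $A_1,A_2\subset\mathbb{R}$ be compact sets of positive Lebesgue measure, $A=A_1\times A_2$, and $\|g\|_A=(\int_A|g|^2)^{1/2}$. Let $\alpha_1,\alpha_2>0$, let $L>0$, let $r_1>\alpha_1$ and $r_2>\alpha_2$ be integers, and let $\bar\alpha$ be the harmonic mean of $\alpha_1$ and $\alpha_2$, i.e. $2/\bar\alpha=1/\alpha_1+1/\alpha_2$. With $e_1=(1,0)$, $e_2=(0,1)$, define for a measurable function $g:\mathbb{R}^2\to\mathbb{R}$ $$\Delta_{h,i}^{r}g(z)=\sum_{k=0}^{r}(-1)^{r-k}\binom{r}{k}g(z+khe_i),\qquad A_{h,i}^r=\{z\in\mathbb{R}^2:\ z,\,z+he_i,\dots,z+rhe_i\in A\},$$ $$\omega_{r,i}(g,t)=\sup_{|h|\le t}\Big(\int_{A_{h,i}^{r}}|\Delta_{h,i}^{r}g(z)|^2dz\Big)^{1/2},\qquad \|g\|_{B_{2,\infty}^{(\alpha_1,\alpha_2)}(A)}=\|g\|_A+\sup_{t>0}\sum_{i=1}^2t^{-\alpha_i}\omega_{r_i,i}(g,t).$$ Let $\mathcal{B}$ be the set of all transition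 densities $\pi$ on $\mathbb{R}$ (that is, $\pi:\mathbb{R}^2\to[0,\infty)$ is measurable and $\int\pi(x,y)\,dy=1$ for every $x$) such that the Markov chain with transition kernel $\pi(x,y)\,dy$ is positive recurrent (irreducible with respect to some nonzero $\sigma$-finite measure, and admitting an invariant probability measure, which is then unique) and $\|\pi\|_{B_{2,\infty}^{(\alpha_1,\alpha_2)}(A)}\le L$. For $\pi\in\mathcal{B}$ let $\mathbb{E}_\pi$ be the expectation under which $X_1,X_2,\dots$ is the Markov chain with transition density $\pi$ started from its stationary distribution. Then there exists a constant $C>0$ such that, for all $n$ large enough, $$\inf_{\hat\pi_n}\ \sup_{\pi\in\mathcal{B}}\ \mathbb{E}_\pi\|\hat\pi_n-\pi\|_A^2\ \ge\ C\,n^{-\frac{2\bar\alpha}{2\bar\alpha+2}},$$ where the infimum is taken over all estimators $\hat\pi_n$ of $\pi$ based on the observations $X_1,\dots,X_{n+1}$. -/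

import Mathlib

open MeasureTheory ProbabilityTheory Filter
open scoped ENNReal

namespace TransitionDensity

noncomputable section

/-- The canonical basis vectors `e₁ = (1, 0)` and `e₂ = (0, 1)` of the plane. -/
def basisVec : Fin 2 → ℝ × ℝ := ![(1, 0), (0, 1)]

/-- The set of all `z` such that `z, z + h eᵢ, …, z + r h eᵢ` belong to `A`. -/
def diffDomain (A : Set (ℝ × ℝ)) (i : Fin 2) (r : ℕ) (h : ℝ) : Set (ℝ × ℝ) :=
  {z | ∀ k : ℕ, k ≤ r → z + ((k : ℝ) * h) • basisVec i ∈ A}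

/-- The `r`-th difference operator with step `h` in direction `i`. -/
def diffOp (i : Fin 2) (r : ℕ) (h : ℝ) (g : ℝ × ℝ → ℝ) (z : ℝ × ℝ) : ℝ :=
  ∑ k ∈ Finset.range (r + 1),
    (-1 : ℝ) ^ (r - k) * (r.choose k : ℝ) * g (z + ((k : ℝ) * h) • basisVec i)

/-- The `L²` norm on a set `A` of the plane, with values in `[0, ∞]`. -/
def l2Norm (A : Set (ℝ × ℝ)) (g : ℝ × ℝ → ℝ) : ℝ≥0∞ :=
  eLpNorm g 2 (volume.restrict A)

/-- The directional modulus of smoothness of order `r` in direction `i`. -/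
def modulus (A : Set (ℝ × ℝ)) (i : Fin 2) (r : ℕ) (g : ℝ × ℝ → ℝ) (t : ℝ) : ℝ≥0∞ :=
  ⨆ (h : ℝ) (_ : |h| ≤ t), l2Norm (diffDomain A i r h) (diffOp i r h g)

/-- The norm of the anisotropic Besov space `B_{2,∞}^{(α₁,α₂)}(A)`: the `L²(A)` norm plus the
Besov seminorm, computed with differences of order `rᵢ` in direction `i`. It is infinite exactly
when the function is not in the space. -/
def besovNorm (A : Set (ℝ × ℝ)) (α : Fin 2 → ℝ) (r : Fin 2 → ℕ) (g : ℝ × ℝ → ℝ) : ℝ≥0∞ :=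
  l2Norm A g +
    ⨆ (t : ℝ) (_ : 0 < t), ∑ i : Fin 2, ENNReal.ofReal (t ^ (-α i)) * modulus A i (r i) g t

/-- `π` is a transition density on the real line: it is nonnegative and measurable, and `π (x, ·)`
is a probability density for every `x`. -/
structure IsTransitionDensity (π : ℝ × ℝ → ℝ) : Prop where
  measurable : Measurable π
  nonneg : ∀ z, 0 ≤ π z
  lintegral_eq_one : ∀ x : ℝ, ∫⁻ y, ENNReal.ofReal (π (x, y)) = 1

/-- The transition kernel `P(x, dy) = π(x, y) dy`. -/
def transitionKernel (π : ℝ × ℝ → ℝ) : Kernel ℝ ℝ :=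
  Kernel.withDensity (Kernel.const ℝ (volume : Measure ℝ)) fun x y => ENNReal.ofReal (π (x, y))

/-- The chain with transition density `π` is positive recurrent with stationary distribution `μ`:
it is irreducible (with respect to some nonzero σ-finite measure), and `μ` is an invariant
probability measure. By irreducibility there is at most one such `μ`. -/
structure IsPositiveRecurrent (π : ℝ × ℝ → ℝ) (μ : Measure ℝ) : Prop where
  irreducible : ∃ φ : Measure ℝ, SigmaFinite φ ∧ φ ≠ 0 ∧
    Kernel.IsIrreducible φ (transitionKernel π)
  prob : IsProbabilityMeasure μ
  invariant : Kernel.Invariant (transitionKernel π) μ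

/-- The class of transition densities of positive recurrent chains on the real line whose Besov
norm on `A` is at most `L`. -/
def besovClass (A : Set (ℝ × ℝ)) (α : Fin 2 → ℝ) (r : Fin 2 → ℕ) (L : ℝ) :
    Set (ℝ × ℝ → ℝ) :=
  {π | IsTransitionDensity π ∧ (∃ μ, IsPositiveRecurrent π μ) ∧
    besovNorm A α r π ≤ ENNReal.ofReal L}

/-- The joint law `μ(dx₁) π(x₁, x₂) dx₂ ⋯ π(xₙ, xₙ₊₁) dxₙ₊₁` of the first `n + 1` observations
`X₁, …, Xₙ₊₁` of the chain with initial distribution `μ` and transition density `π`. -/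
def chainLaw (π : ℝ × ℝ → ℝ) (μ : Measure ℝ) (n : ℕ) : Measure (Fin (n + 1) → ℝ) :=
  (Measure.pi (Fin.cons μ fun _ => volume : Fin (n + 1) → Measure ℝ)).withDensity
    fun x => ∏ i : Fin n, ENNReal.ofReal (π (x i.castSucc, x i.succ))

/-- The expected squared `L²(A)` loss of `est` for the chain with initial distribution `μ` and
transition density `π`. -/
def risk (A : Set (ℝ × ℝ)) (n : ℕ) (est : (Fin (n + 1) → ℝ) → ℝ × ℝ → ℝ)
    (π : ℝ × ℝ → ℝ) (μ : Measure ℝ) : ℝ≥0∞ :=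
  ∫⁻ x, l2Norm A (fun z => est x z - π z) ^ 2 ∂chainLaw π μ n

/-- The minimax risk over the Besov class: the infimum runs over all (jointly measurable)
estimators based on `X₁, …, Xₙ₊₁`, and the chain is started from its stationary distribution. -/
def minimaxRisk (A : Set (ℝ × ℝ)) (α : Fin 2 → ℝ) (r : Fin 2 → ℕ) (L : ℝ) (n : ℕ) : ℝ≥0∞ :=
  ⨅ (est : (Fin (n + 1) → ℝ) → ℝ × ℝ → ℝ) (_ : Measurable (Function.uncurry est)),
    ⨆ (π : ℝ × ℝ → ℝ) (_ : π ∈ besovClass A α r L) (μ : Measure ℝ)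
      (_ : IsPositiveRecurrent π μ), risk A n est π μ

/-- The harmonic mean `ᾱ` of `α₁` and `α₂`, that is, `2 / ᾱ = 1 / α₁ + 1 / α₂`. -/
def harmonicMean (α : Fin 2 → ℝ) : ℝ := 2 / (1 / α 0 + 1 / α 1)

end

end TransitionDensity

/-! The bound is Assouad's hypercube method around an i.i.d. chain. Take the uniform density `f` on
`[-M, M]` as base and perturb it to `f y * (1 + a * G_S (x, y))`, where `G_S` sums products of
rescaled bumps over a set `S` of grid cells with sides `h 0`, `h 1`. The bump has mean zero, so
integrating out either variable leaves `1`: every perturbed kernel is a transition density, keeps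
the uniform law invariant, and dominates `2/3` of that law, hence is irreducible
(`isPositiveRecurrent_mul`). All path laws then have explicit product densities with respect to one
product measure (`chainLaw_mul`).

Toggling one cell changes the transition density by a squared `L²` distance of order `a² h₀ h₁`.
When `n` times this is small, the two path laws overlap by at least `1/4`
(`le_lintegral_min_pathDensity`). With `a = κ b` and `h i = b ^ (1 / α i)` the Besov seminorm stays
bounded (`besovNorm_le`), and `n b² h₀ h₁ = 1` fixes `b² = n ^ (-2ᾱ / (2ᾱ + 2))`, which is the rate.

The compact sets may contain no whole cell, so the usual count of cells inside `A` is unavailable.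
Two devices replace it. `assouad` works point by point: at each `z` the parameters are paired by
toggling the cell containing `z`, and the separation is then integrated over `A`. Averaging over
translates of the grid (`exists_shift`) gives a shift for which the squared bumps have integral over
each `A_i` at least a fixed multiple of its measure. -/

/-! ### Densities on finite products -/

/-- Tonelli's theorem for a product of functions of the separate coordinates. -/
lemma lintegral_fin_prod_eq_prod {n : ℕ} (m : Fin n → Measure ℝ) [∀ i, SigmaFinite (m i)]
    (f : Fin n → ℝ → ℝ≥0∞) (hf : ∀ i, Measurable (f i)) :
    ∫⁻ x, ∏ i, f i (x i) ∂Measure.pi m = ∏ i, ∫⁻ t, f i t ∂m i := by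
  induction n with
  | zero => simp
  | succ n ih =>
    have h := (measurePreserving_piFinSuccAbove m 0).symm
    rw [← h.lintegral_comp_emb (MeasurableEquiv.measurableEmbedding _),
      Fin.prod_univ_succ, ← ih (fun i => m i.succ) (fun i => f i.succ) (fun i => hf _)]
    simp only [Fin.prod_univ_succ]
    have hm : Measurable fun x : Fin n → ℝ => ∏ i, f i.succ (x i) :=
      Finset.measurable_fun_prod _ fun i _ => (hf _).comp (measurable_pi_apply i)
    rw [← lintegral_prod_mul (hf 0).aemeasurable hm.aemeasurable]
    rfl

/-- The law of `n` coordinates having densities `f i`. -/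
lemma pi_withDensity_fin {n : ℕ} (m : Fin n → Measure ℝ) [∀ i, SigmaFinite (m i)]
    (f : Fin n → ℝ → ℝ≥0∞) (hf : ∀ i, Measurable (f i))
    [∀ i, SigmaFinite ((m i).withDensity (f i))] :
    Measure.pi (fun i => (m i).withDensity (f i)) =
      (Measure.pi m).withDensity fun x => ∏ i, f i (x i) := by
  refine Measure.pi_eq fun s hs => ?_
  rw [withDensity_apply _ (MeasurableSet.univ_pi hs),
    ← lintegral_indicator (MeasurableSet.univ_pi hs)]
  have h : (Set.univ.pi s).indicator (fun x : Fin n → ℝ => ∏ i, f i (x i)) =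
      fun x => ∏ i, (s i).indicator (f i) (x i) := by
    ext x
    by_cases hx : x ∈ Set.univ.pi s
    · rw [Set.indicator_of_mem hx]
      exact Finset.prod_congr rfl fun i _ => (Set.indicator_of_mem (hx i trivial) _).symm
    · rw [Set.indicator_of_notMem hx]
      obtain ⟨i, hi⟩ : ∃ i, x i ∉ s i := by simpa [Set.mem_pi] using hx
      exact (Finset.prod_eq_zero (Finset.mem_univ i) (Set.indicator_of_notMem hi _)).symm
  rw [h, lintegral_fin_prod_eq_prod _ _ fun i => (hf i).indicator (hs i)]
  refine Finset.prod_congr rfl fun i _ => ?_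
  rw [withDensity_apply _ (hs i), lintegral_indicator (hs i)]

/-! ### Path densities of a stationary chain -/

/-- A jointly measurable function with both conditional integrals equal to one: the density of a
coupling of `μ` with itself. -/
structure IsCouplingDensity (μ : Measure ℝ) (D : ℝ × ℝ → ℝ≥0∞) : Prop where
  measurable : Measurable D
  lintegral_right : ∀ x, ∫⁻ y, D (x, y) ∂μ = 1
  lintegral_left : ∀ y, ∫⁻ x, D (x, y) ∂μ = 1

/-- The density of the stationary chain with transition density `D` with respect to the product
measure. -/
noncomputable def pathDensity (D : ℝ × ℝ → ℝ≥0∞) (n : ℕ) (x : Fin (n + 1) → ℝ) : ℝ≥0∞ :=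
  ∏ i : Fin n, D (x i.castSucc, x i.succ)

section Chain

variable {μ : Measure ℝ} [IsProbabilityMeasure μ] {D : ℝ × ℝ → ℝ≥0∞}

lemma measurable_pathDensity (hD : Measurable D) (n : ℕ) :
    Measurable (pathDensity D n) := by
  refine Finset.measurable_fun_prod _ fun i _ => ?_
  exact hD.comp ((measurable_pi_apply i.castSucc).prodMk (measurable_pi_apply i.succ))

/-- The last state occurs in a single factor, which integrates to one by `lintegral_right`. -/
lemma lintegral_pathDensity_init (hD : IsCouplingDensity μ D) (n : ℕ)
    {H : (Fin (n + 1) → ℝ) → ℝ≥0∞} (hH : Measurable H) :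
    ∫⁻ x, H (fun i => x i.castSucc) * pathDensity D (n + 1) x ∂Measure.pi (fun _ => μ) =
      ∫⁻ x, H x * pathDensity D n x ∂Measure.pi (fun _ => μ) := by
  have h := (measurePreserving_piFinSuccAbove (fun _ : Fin (n + 2) => μ) (Fin.last _)).symm
  have hm := measurable_pathDensity hD.measurable n
  have hl : Measurable fun z : ℝ × (Fin (n + 1) → ℝ) => D (z.2 (Fin.last n), z.1) :=
    hD.measurable.comp (((measurable_pi_apply _).comp measurable_snd).prodMk measurable_fst)
  have hg : Measurable fun z : ℝ × (Fin (n + 1) → ℝ) =>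
      H z.2 * pathDensity D n z.2 * D (z.2 (Fin.last n), z.1) :=
    (((hH.comp measurable_snd).mul (hm.comp measurable_snd))).mul hl
  rw [← h.lintegral_comp_emb (MeasurableEquiv.measurableEmbedding _)]
  calc _ = ∫⁻ z : ℝ × (Fin (n + 1) → ℝ), H z.2 * pathDensity D n z.2 * D (z.2 (Fin.last n), z.1)
        ∂(μ.prod (Measure.pi fun _ => μ)) := by
        refine lintegral_congr fun z => ?_
        simp [pathDensity, Fin.prod_univ_castSucc, MeasurableEquiv.piFinSuccAbove,
          Fin.insertNthEquiv, mul_assoc, ← Fin.castSucc_succ]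
    _ = _ := by
        rw [lintegral_prod_symm' _ hg]
        refine lintegral_congr fun x => ?_
        have : Measurable fun y => D (x (Fin.last n), y) :=
          hD.measurable.comp (measurable_const.prodMk measurable_id)
        simp [lintegral_const_mul _ this, hD.lintegral_right]

/-- The first state occurs in a single factor, which integrates to one by `lintegral_left`; this is
stationarity. -/
lemma lintegral_pathDensity_tail (hD : IsCouplingDensity μ D) (n : ℕ)
    {H : (Fin (n + 1) → ℝ) → ℝ≥0∞} (hH : Measurable H) :
    ∫⁻ x, H (fun i => x i.succ) * pathDensity D (n + 1) x ∂Measure.pi (fun _ => μ) =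
      ∫⁻ x, H x * pathDensity D n x ∂Measure.pi (fun _ => μ) := by
  have h := (measurePreserving_piFinSuccAbove (fun _ : Fin (n + 2) => μ) 0).symm
  have hm := measurable_pathDensity hD.measurable n
  have hl : Measurable fun z : ℝ × (Fin (n + 1) → ℝ) => D (z.1, z.2 0) :=
    hD.measurable.comp (measurable_fst.prodMk ((measurable_pi_apply _).comp measurable_snd))
  have hg : Measurable fun z : ℝ × (Fin (n + 1) → ℝ) =>
      H z.2 * pathDensity D n z.2 * D (z.1, z.2 0) :=
    (((hH.comp measurable_snd).mul (hm.comp measurable_snd))).mul hl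
  rw [← h.lintegral_comp_emb (MeasurableEquiv.measurableEmbedding _)]
  calc _ = ∫⁻ z : ℝ × (Fin (n + 1) → ℝ), H z.2 * pathDensity D n z.2 * D (z.1, z.2 0)
        ∂(μ.prod (Measure.pi fun _ => μ)) := by
        refine lintegral_congr fun z => ?_
        simp [pathDensity, Fin.prod_univ_succ, MeasurableEquiv.piFinSuccAbove,
          Fin.insertNthEquiv, ← Fin.succ_castSucc, -Fin.castSucc_succ]
        ring
    _ = _ := by
        rw [lintegral_prod_symm' _ hg]
        refine lintegral_congr fun x => ?_
        have : Measurable fun y => D (y, x 0) :=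
          hD.measurable.comp (measurable_id.prodMk measurable_const)
        simp [lintegral_const_mul _ this, hD.lintegral_left]

lemma lintegral_pathDensity (hD : IsCouplingDensity μ D) (n : ℕ) :
    ∫⁻ x, pathDensity D n x ∂Measure.pi (fun _ => μ) = 1 := by
  induction n with
  | zero => simp [pathDensity]
  | succ n ih =>
    have := lintegral_pathDensity_init hD n (H := fun _ => 1) measurable_const
    simpa [ih] using this

/-- Consecutive states of the stationary chain have joint density `D`. -/
lemma lintegral_pathDensity_pair (hD : IsCouplingDensity μ D) (n : ℕ) (i : Fin n)
    {G : ℝ × ℝ → ℝ≥0∞} (hG : Measurable G) :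
    ∫⁻ x, G (x i.castSucc, x i.succ) * pathDensity D n x ∂Measure.pi (fun _ => μ) =
      ∫⁻ z, G z * D z ∂(μ.prod μ) := by
  induction n with
  | zero => exact i.elim0
  | succ n ih =>
    rcases n with _ | n
    · obtain rfl : i = 0 := Fin.fin_one_eq_zero i
      have h := measurePreserving_finTwoArrow μ
      have hm : Measurable fun z => G z * D z := hG.mul hD.measurable
      rw [← h.lintegral_comp hm]
      refine lintegral_congr fun x => ?_
      simp [pathDensity, MeasurableEquiv.finTwoArrow]
    · have hp : ∀ j : Fin (n + 1), Measurable fun x : Fin (n + 2) → ℝ =>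
          G (x j.castSucc, x j.succ) := fun j =>
        hG.comp ((measurable_pi_apply _).prodMk (measurable_pi_apply _))
      -- A pair avoiding the last state survives dropping that state; the final pair survives
      -- dropping the first one. Either way the path shortens, down to two states.
      rcases Fin.eq_castSucc_or_eq_last i with ⟨j, rfl⟩ | rfl
      · rw [← ih j, ← lintegral_pathDensity_init hD (n + 1) (hp j)]
        rfl
      · rw [← ih (Fin.last n), ← lintegral_pathDensity_tail hD (n + 1) (hp (Fin.last n))]
        rfl

end Chain

/-! ### Overlap of two path laws -/

/-- With `q = p * t ^ 2` the left side is the geometric mean of `p` and `q`. The claim thus bounds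
the Hellinger affinity by the overlap plus a small share of the total mass. In each case the
difference is a positive multiple of a square plus a nonnegative remainder. -/
lemma le_two_mul_min_add (p t : ℝ) (hp : 0 ≤ p) :
    p * t ≤ 2 * min p (p * t ^ 2) + (p + p * t ^ 2) / 8 := by
  rcases le_total p (p * t ^ 2) with h | h
  · rw [min_eq_left h]
    nlinarith [mul_nonneg hp (sq_nonneg (t - 4))]
  · rw [min_eq_right h]
    nlinarith [mul_nonneg hp (sq_nonneg (17 * t - 4))]

/-- A lower bound for the minimum of two products in terms of the ratios of their factors. -/
lemma prod_mul_le_min_prod {ι : Type*} (s : Finset ι) (a b : ι → ℝ) (ha : ∀ i, 0 < a i)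
    (hb : ∀ i, 0 < b i) :
    (∏ i ∈ s, a i) * (1 + s.card / 2) ≤ 2 * min (∏ i ∈ s, a i) (∏ i ∈ s, b i) +
      ((∏ i ∈ s, a i) + ∏ i ∈ s, b i) / 8 + (∑ i ∈ s, (∏ i ∈ s, a i) * (a i / b i)) / 2 := by
  set p := ∏ i ∈ s, a i with hp
  have hp0 : 0 < p := Finset.prod_pos fun i _ => ha i
  -- `t` is the square root of the likelihood ratio `∏ b i / ∏ a i`.
  set t := Real.exp ((∑ i ∈ s, Real.log (b i / a i)) / 2) with ht
  have h1 : p * t ^ 2 = ∏ i ∈ s, b i := by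
    rw [ht, ← Real.exp_nat_mul]
    have : ((2 : ℕ) : ℝ) * ((∑ i ∈ s, Real.log (b i / a i)) / 2) =
        ∑ i ∈ s, Real.log (b i / a i) := by push_cast; ring
    rw [this, Real.exp_sum, hp, ← Finset.prod_mul_distrib]
    refine Finset.prod_congr rfl fun i _ => ?_
    rw [Real.exp_log (div_pos (hb i) (ha i)), mul_div_cancel₀ _ (ha i).ne']
  -- Two tangent-line bounds, `exp u ≥ 1 + u` and `log u ≥ 1 - 1 / u`, turn the product of ratios
  -- into a sum, whose integral needs only the law of consecutive pairs.
  have h2 : 1 + (∑ i ∈ s, (1 - a i / b i)) / 2 ≤ t := by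
    refine le_trans ?_ (Real.add_one_le_exp _)
    have : ∑ i ∈ s, (1 - a i / b i) ≤ ∑ i ∈ s, Real.log (b i / a i) :=
      Finset.sum_le_sum fun i _ => by
        simpa using Real.one_sub_inv_le_log_of_pos (div_pos (hb i) (ha i))
    linarith
  have h3 := le_two_mul_min_add p t hp0.le
  rw [h1] at h3
  have h4 := mul_le_mul_of_nonneg_left h2 hp0.le
  rw [Finset.sum_sub_distrib, Finset.sum_const, nsmul_eq_mul, mul_one] at h4
  rw [← Finset.mul_sum]
  linarith

section Affinity

variable {μ : Measure ℝ} {w w' : ℝ × ℝ → ℝ}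

/-- This is a chi-square bound: `a² / b + b = 2a + (a - b)² / b` with `b = 1 + w' ≥ 2/3`. The term
`b` stays on the left until integrated, which avoids subtraction in `ℝ≥0∞`. -/
lemma lintegral_sq_div_le (hw : Measurable w) (hw' : Measurable w')
    (hwb : ∀ z, |w z| ≤ 1 / 3) (hwb' : ∀ z, |w' z| ≤ 1 / 3)
    (h1 : ∫⁻ z, ENNReal.ofReal (1 + w z) ∂μ.prod μ = 1)
    (h1' : ∫⁻ z, ENNReal.ofReal (1 + w' z) ∂μ.prod μ = 1) :
    ∫⁻ z, ENNReal.ofReal ((1 + w z) / (1 + w' z)) * ENNReal.ofReal (1 + w z) ∂μ.prod μ ≤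
      1 + ENNReal.ofReal (3 / 2) * ∫⁻ z, ENNReal.ofReal ((w z - w' z) ^ 2) ∂μ.prod μ := by
  have hpt : ∀ z, ENNReal.ofReal ((1 + w z) / (1 + w' z)) * ENNReal.ofReal (1 + w z) +
      ENNReal.ofReal (1 + w' z) ≤ 2 * ENNReal.ofReal (1 + w z) +
        ENNReal.ofReal (3 / 2) * ENNReal.ofReal ((w z - w' z) ^ 2) := by
    intro z
    have a1 := abs_le.1 (hwb z)
    have a2 := abs_le.1 (hwb' z)
    have hb : 0 < 1 + w' z := by linarith
    have ha : 0 < 1 + w z := by linarith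
    rw [← ENNReal.ofReal_mul (by positivity), ← ENNReal.ofReal_add (by positivity) hb.le,
      ← ENNReal.ofReal_mul (by positivity), ← ENNReal.ofReal_ofNat, ← ENNReal.ofReal_mul (by simp),
      ← ENNReal.ofReal_add (by positivity) (by positivity)]
    refine ENNReal.ofReal_le_ofReal ?_
    have h2 : (1 + w z) / (1 + w' z) * (1 + w z) + (1 + w' z) =
        2 * (1 + w z) + (w z - w' z) ^ 2 / (1 + w' z) := by field_simp; ring
    have h3 : (w z - w' z) ^ 2 / (1 + w' z) ≤ 3 / 2 * (w z - w' z) ^ 2 := by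
      rw [div_le_iff₀ hb]
      nlinarith [sq_nonneg (w z - w' z)]
    rw [h2]
    linarith
  have h := lintegral_mono (μ := μ.prod μ) hpt
  rw [lintegral_add_right _ (by fun_prop), lintegral_add_right _ (by fun_prop),
    lintegral_const_mul _ (by fun_prop), lintegral_const_mul _ (by fun_prop), h1, h1'] at h
  refine ENNReal.le_of_add_le_add_right ENNReal.one_ne_top (h.trans_eq ?_)
  ring

/-- Two stationary chains whose transition densities are close have path laws that overlap. -/
lemma le_lintegral_min_pathDensity [IsProbabilityMeasure μ] (hw : Measurable w) (hw' : Measurable w')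
    (hwb : ∀ z, |w z| ≤ 1 / 3) (hwb' : ∀ z, |w' z| ≤ 1 / 3)
    (hD : IsCouplingDensity μ fun z => ENNReal.ofReal (1 + w z))
    (hD' : IsCouplingDensity μ fun z => ENNReal.ofReal (1 + w' z)) (n : ℕ)
    (hn : n * ∫⁻ z, ENNReal.ofReal ((w z - w' z) ^ 2) ∂μ.prod μ ≤ ENNReal.ofReal (1 / 3)) :
    ENNReal.ofReal (1 / 4) ≤ ∫⁻ x, min (pathDensity (fun z => ENNReal.ofReal (1 + w z)) n x)
      (pathDensity (fun z => ENNReal.ofReal (1 + w' z)) n x) ∂Measure.pi (fun _ => μ) := by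
  have hpos : ∀ {v : ℝ × ℝ → ℝ}, (∀ z, |v z| ≤ 1 / 3) → ∀ z, 0 < 1 + v z := fun hv z => by
    have := abs_le.1 (hv z); linarith
  set D := fun z => ENNReal.ofReal (1 + w z)
  set D' := fun z => ENNReal.ofReal (1 + w' z)
  have mD := measurable_pathDensity hD.measurable n
  have mD' := measurable_pathDensity hD'.measurable n
  have hprod : ∀ {D : ℝ × ℝ → ℝ≥0∞}, IsCouplingDensity μ D → ∫⁻ z, D z ∂μ.prod μ = 1 := by
    intro D hD
    rw [lintegral_prod _ hD.measurable.aemeasurable]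
    simp [hD.lintegral_right]
  set R : ℝ × ℝ → ℝ≥0∞ := fun z => ENNReal.ofReal ((1 + w z) / (1 + w' z))
  have mR : Measurable R := by fun_prop
  have mRi : ∀ i : Fin n, Measurable fun x : Fin (n + 1) → ℝ => R (x i.castSucc, x i.succ) :=
    fun i => mR.comp ((measurable_pi_apply _).prodMk (measurable_pi_apply _))
  have hpt : ∀ x, pathDensity D n x * ENNReal.ofReal (1 + n / 2) ≤
      2 * min (pathDensity D n x) (pathDensity D' n x) + ENNReal.ofReal (1 / 8) *
        (pathDensity D n x + pathDensity D' n x) + ENNReal.ofReal (1 / 2) *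
          ∑ i : Fin n, R (x i.castSucc, x i.succ) * pathDensity D n x := by
    intro x
    have h := prod_mul_le_min_prod Finset.univ
      (fun i : Fin n => 1 + w (x i.castSucc, x i.succ))
      (fun i : Fin n => 1 + w' (x i.castSucc, x i.succ)) (fun i => hpos hwb _)
      (fun i => hpos hwb' _)
    have e1 : pathDensity D n x =
        ENNReal.ofReal (∏ i : Fin n, (1 + w (x i.castSucc, x i.succ))) :=
      (ENNReal.ofReal_prod_of_nonneg fun i _ => (hpos hwb _).le).symm
    have e2 : pathDensity D' n x =
        ENNReal.ofReal (∏ i : Fin n, (1 + w' (x i.castSucc, x i.succ))) :=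
      (ENNReal.ofReal_prod_of_nonneg fun i _ => (hpos hwb' _).le).symm
    set P := ∏ i : Fin n, (1 + w (x i.castSucc, x i.succ))
    set P' := ∏ i : Fin n, (1 + w' (x i.castSucc, x i.succ))
    have hP : 0 ≤ P := Finset.prod_nonneg fun i _ => (hpos hwb _).le
    have hP' : 0 ≤ P' := Finset.prod_nonneg fun i _ => (hpos hwb' _).le
    have hS : ∀ i : Fin n, 0 ≤ P * ((1 + w (x i.castSucc, x i.succ)) /
        (1 + w' (x i.castSucc, x i.succ))) := fun i =>
      mul_nonneg hP (div_pos (hpos hwb _) (hpos hwb' _)).le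
    have e3 : ∑ i : Fin n, R (x i.castSucc, x i.succ) * pathDensity D n x =
        ENNReal.ofReal (∑ i : Fin n, P * ((1 + w (x i.castSucc, x i.succ)) /
          (1 + w' (x i.castSucc, x i.succ)))) := by
      rw [ENNReal.ofReal_sum_of_nonneg fun i _ => hS i]
      refine Finset.sum_congr rfl fun i _ => ?_
      rw [ENNReal.ofReal_mul hP, e1, mul_comm]
    rw [e3, e1, e2, ← ENNReal.ofReal_min, ← ENNReal.ofReal_add hP hP', ← ENNReal.ofReal_mul hP,
      ← ENNReal.ofReal_mul (by positivity), ← ENNReal.ofReal_mul (by positivity),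
      ← ENNReal.ofReal_ofNat, ← ENNReal.ofReal_mul (by simp),
      ← ENNReal.ofReal_add (by positivity) (by positivity),
      ← ENNReal.ofReal_add (by positivity)
        (mul_nonneg (by norm_num) (Finset.sum_nonneg fun i _ => hS i))]
    refine ENNReal.ofReal_le_ofReal ?_
    simp only [Finset.card_univ, Fintype.card_fin] at h
    linarith
  have h := lintegral_mono (μ := Measure.pi fun _ => μ) hpt
  have hmin := mD.min mD'
  set I := ∫⁻ x, min (pathDensity D n x) (pathDensity D' n x) ∂Measure.pi (fun _ => μ)
  set X := ∫⁻ z, R z * D z ∂μ.prod μ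
  have hX : X ≤ 1 + ENNReal.ofReal (3 / 2) * _ :=
    lintegral_sq_div_le hw hw' hwb hwb' (hprod hD) (hprod hD')
  have mRp : ∀ i : Fin n, Measurable fun x : Fin (n + 1) → ℝ =>
      R (x i.castSucc, x i.succ) * pathDensity D n x := fun i => (mRi i).mul mD
  have msum : Measurable fun x => ∑ i : Fin n, R (x i.castSucc, x i.succ) * pathDensity D n x :=
    Finset.measurable_fun_sum _ fun i _ => mRp i
  have madd : Measurable fun x => pathDensity D n x + pathDensity D' n x := mD.add mD'
  rw [lintegral_mul_const _ mD, lintegral_add_right _ (msum.const_mul _),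
    lintegral_add_right _ (madd.const_mul _), lintegral_const_mul _ hmin,
    lintegral_const_mul _ madd, lintegral_const_mul _ msum, lintegral_add_left mD,
    lintegral_finsetSum _ (fun i _ => mRp i),
    lintegral_pathDensity hD, lintegral_pathDensity hD',
    Finset.sum_congr rfl fun i _ => lintegral_pathDensity_pair hD n i mR] at h
  simp only [Finset.sum_const, Finset.card_univ, Fintype.card_fin, nsmul_eq_mul, one_mul] at h
  change _ ≤ 2 * I + ENNReal.ofReal (1 / 8) * (1 + 1) + ENNReal.ofReal (1 / 2) * (n * X) at h
  -- The `n` transitions cost at most `3/2 * 1/3 = 1/2` in total beyond `n`. The integrated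
  -- inequality then reads `1 + n/2 ≤ 2 I + 1/4 + n/2 + 1/4`, that is `I ≥ 1/4`.
  have hnX : (n : ℝ≥0∞) * X ≤ ENNReal.ofReal (n + 1 / 2) := by
    calc (n : ℝ≥0∞) * X ≤ n * (1 + ENNReal.ofReal (3 / 2) * _) := by gcongr
      _ = n + ENNReal.ofReal (3 / 2) *
          (n * ∫⁻ z, ENNReal.ofReal ((w z - w' z) ^ 2) ∂μ.prod μ) := by ring
      _ ≤ n + ENNReal.ofReal (3 / 2) * ENNReal.ofReal (1 / 3) := by gcongr
      _ = _ := by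
        rw [← ENNReal.ofReal_natCast, ← ENNReal.ofReal_mul (by norm_num),
          ← ENNReal.ofReal_add (by positivity) (by norm_num)]
        norm_num
  by_contra! hI
  have hI' : I ≠ ∞ := hI.ne_top
  rw [← ENNReal.ofReal_toReal hI'] at h hI
  have hI2 := (ENNReal.ofReal_lt_ofReal_iff (by norm_num)).1 hI
  have h5 : ENNReal.ofReal (1 + n / 2) ≤ ENNReal.ofReal (2 * I.toReal + 1 / 8 * 2 +
      1 / 2 * (n + 1 / 2)) := by
    refine h.trans ?_
    rw [ENNReal.ofReal_add (by positivity) (by positivity),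
      ENNReal.ofReal_add (by positivity) (by positivity), ENNReal.ofReal_mul (by positivity),
      ENNReal.ofReal_mul (p := 1 / 8) (by positivity), ENNReal.ofReal_mul (p := 1 / 2) (by positivity)]
    gcongr
    · simp
    · rw [one_add_one_eq_two]; simp
  rw [ENNReal.ofReal_le_ofReal_iff (by positivity)] at h5
  linarith

end Affinity

/-! ### Assouad's lemma with a pairing that depends on the point -/

lemma ofReal_sq_sub_le (e a b : ℝ) :
    ENNReal.ofReal ((a - b) ^ 2) ≤
      2 * (ENNReal.ofReal ((e - a) ^ 2) + ENNReal.ofReal ((e - b) ^ 2)) := by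
  rw [← ENNReal.ofReal_add (by positivity) (by positivity), ← ENNReal.ofReal_ofNat,
    ← ENNReal.ofReal_mul (by norm_num)]
  exact ENNReal.ofReal_le_ofReal (by nlinarith [sq_nonneg (e - a + (e - b))])

/-- Assouad's lemma: if at every point `z` the parameters can be paired in such a way that
paired parameters are hard to tell apart but differ by a prescribed amount at `z`, then the
maximal quadratic risk is bounded below. -/
lemma assouad {Ω Z Θ : Type*} [MeasurableSpace Ω] [MeasurableSpace Z] (ν : Measure Ω)
    (lam : Measure Z) [SFinite ν] [SFinite lam] (s : Finset Θ) (hs : s.Nonempty)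
    (p : Θ → Ω → ℝ≥0∞) (hp : ∀ θ, Measurable (p θ)) (g : Θ → Z → ℝ)
    (hg : ∀ θ, Measurable (g θ)) (est : Ω → Z → ℝ) (hest : Measurable (Function.uncurry est))
    (T : Z → ℝ≥0∞) (hT : Measurable T)
    (hpair : ∀ z, ∃ σ : Θ → Θ, (∀ θ ∈ s, σ θ ∈ s) ∧ (∀ θ ∈ s, σ (σ θ) = θ) ∧
      ∀ θ ∈ s, T z ≤ ENNReal.ofReal ((g θ z - g (σ θ) z) ^ 2) ∧
        ENNReal.ofReal (1 / 4) ≤ ∫⁻ x, min (p θ x) (p (σ θ) x) ∂ν) :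
    ∃ θ ∈ s, ENNReal.ofReal (1 / 16) * ∫⁻ z, T z ∂lam ≤
      ∫⁻ x, p θ x * ∫⁻ z, ENNReal.ofReal ((est x z - g θ z) ^ 2) ∂lam ∂ν := by
  have hloss : ∀ θ, Measurable fun q : Ω × Z =>
      ENNReal.ofReal ((est q.1 q.2 - g θ q.2) ^ 2) := fun θ =>
    ((hest.sub ((hg θ).comp measurable_snd)).pow_const 2).ennreal_ofReal
  have hsum : ∑ θ ∈ s, ENNReal.ofReal (1 / 16) * ∫⁻ z, T z ∂lam ≤
      ∑ θ ∈ s, ∫⁻ x, p θ x * ∫⁻ z, ENNReal.ofReal ((est x z - g θ z) ^ 2) ∂lam ∂ν := by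
    -- Putting the integral over `z` outside lets the pairing `σ` be chosen separately for each `z`.
    have hswap : ∀ θ, ∫⁻ x, p θ x * ∫⁻ z, ENNReal.ofReal ((est x z - g θ z) ^ 2) ∂lam ∂ν =
        ∫⁻ z, ∫⁻ x, p θ x * ENNReal.ofReal ((est x z - g θ z) ^ 2) ∂ν ∂lam := by
      intro θ
      rw [← lintegral_lintegral_swap
        (f := fun x z => p θ x * ENNReal.ofReal ((est x z - g θ z) ^ 2))
        (((hp θ).comp measurable_fst).mul (hloss θ)).aemeasurable]
      refine lintegral_congr fun x => ?_
      exact (lintegral_const_mul _ ((hloss θ).comp measurable_prodMk_left)).symm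
    simp only [hswap]
    have hmz : ∀ θ, Measurable fun z =>
        ∫⁻ x, p θ x * ENNReal.ofReal ((est x z - g θ z) ^ 2) ∂ν := fun θ =>
      Measurable.lintegral_prod_left' (((hp θ).comp measurable_fst).mul (hloss θ))
    rw [← lintegral_finsetSum _ fun θ _ => hmz θ, Finset.sum_const, nsmul_eq_mul,
      ← mul_assoc, ← lintegral_const_mul _ hT]
    refine lintegral_mono fun z => ?_
    obtain ⟨σ, hσ, hσσ, h⟩ := hpair z
    set F : Θ → ℝ≥0∞ := fun θ => ∫⁻ x, p θ x * ENNReal.ofReal ((est x z - g θ z) ^ 2) ∂ν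
    have hmx : ∀ θ, Measurable fun x => p θ x * ENNReal.ofReal ((est x z - g θ z) ^ 2) := fun θ =>
      (hp θ).mul ((hloss θ).comp measurable_prodMk_right)
    have hF : ∀ θ ∈ s, ENNReal.ofReal (1 / 4) * T z ≤ 2 * (F θ + F (σ θ)) := by
      intro θ hθ
      have hma : Measurable fun x => p θ x * ENNReal.ofReal ((est x z - g θ z) ^ 2) +
          p (σ θ) x * ENNReal.ofReal ((est x z - g (σ θ) z) ^ 2) := (hmx θ).add (hmx _)
      rw [← lintegral_add_left (hmx θ), ← lintegral_const_mul _ hma]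
      calc _ ≤ (∫⁻ x, min (p θ x) (p (σ θ) x) ∂ν) * T z := by gcongr; exact (h θ hθ).2
        _ = ∫⁻ x, min (p θ x) (p (σ θ) x) * T z ∂ν :=
            (lintegral_mul_const _ ((hp θ).min (hp _))).symm
        _ ≤ _ := by
            refine lintegral_mono fun x => ?_
            calc _ ≤ min (p θ x) (p (σ θ) x) * (2 * (ENNReal.ofReal ((est x z - g θ z) ^ 2) +
                  ENNReal.ofReal ((est x z - g (σ θ) z) ^ 2))) := by
                  gcongr
                  exact (h θ hθ).1.trans (ofReal_sq_sub_le _ _ _)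
              _ = 2 * (min (p θ x) (p (σ θ) x) * ENNReal.ofReal ((est x z - g θ z) ^ 2) +
                  min (p θ x) (p (σ θ) x) * ENNReal.ofReal ((est x z - g (σ θ) z) ^ 2)) := by ring
              _ ≤ _ := by
                  gcongr
                  · exact min_le_left _ _
                  · exact min_le_right _ _
    -- As `σ` is an involution of `s`, the paired risks have the same sum, so each risk is counted
    -- twice; with the factor `2` this gives the `4` below.
    have hre : ∑ θ ∈ s, F (σ θ) = ∑ θ ∈ s, F θ :=
      Finset.sum_nbij' σ σ hσ hσ hσσ hσσ fun _ _ => rfl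
    have h4 : (s.card : ℝ≥0∞) * (ENNReal.ofReal (1 / 4) * T z) ≤ 4 * ∑ θ ∈ s, F θ := by
      have := Finset.sum_le_sum hF
      rw [Finset.sum_const, nsmul_eq_mul, ← Finset.mul_sum, Finset.sum_add_distrib, hre] at this
      refine this.trans_eq ?_
      ring
    have h16 : ENNReal.ofReal (1 / 4) = 4 * ENNReal.ofReal (1 / 16) := by
      rw [← ENNReal.ofReal_ofNat, ← ENNReal.ofReal_mul (by norm_num)]; norm_num
    rw [h16] at h4
    refine (ENNReal.mul_le_mul_iff_right (a := 4) (by simp) (by simp)).1 (le_trans (le_of_eq ?_) h4)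
    ring
  -- The largest risk is at least the average.
  obtain ⟨θ, hθ, hmax⟩ := s.exists_max_image
    (fun θ => ∫⁻ x, p θ x * ∫⁻ z, ENNReal.ofReal ((est x z - g θ z) ^ 2) ∂lam ∂ν) hs
  refine ⟨θ, hθ, ?_⟩
  have h := hsum.trans (Finset.sum_le_card_nsmul s _ _ hmax)
  rw [Finset.sum_const, nsmul_eq_mul, nsmul_eq_mul] at h
  exact (ENNReal.mul_le_mul_iff_right (by simpa using hs.ne_empty) (by simp)).1 h

/-! ### The bump profile, finite differences and tilings -/

section Profile

open scoped ContDiff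

/-- A smooth oscillating bump supported in the unit interval. -/
structure IsProfile (φ : ℝ → ℝ) : Prop where
  contDiff : ContDiff ℝ ∞ φ
  eq_zero : ∀ x, x ∉ Set.Ioo (0 : ℝ) 1 → φ x = 0
  iteratedDeriv_eq_zero : ∀ r x, x ∉ Set.Ioo (0 : ℝ) 1 → iteratedDeriv r φ x = 0
  abs_le_one : ∀ x, |φ x| ≤ 1
  integral_eq_zero : ∫ x, φ x = 0
  integral_sq_pos : 0 < ∫ x, φ x ^ 2
  exists_bound : ∀ r, ∃ B, ∀ x, |iteratedDeriv r φ x| ≤ B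

/-- The difference of two disjoint translates of one smooth bump, centred at `1/4` and `3/4` with
radius `1/8`, has mean zero and support inside the open unit interval. -/
lemma exists_isProfile : ∃ φ, IsProfile φ := by
  let b : ContDiffBump (0 : ℝ) := ⟨1 / 16, 1 / 8, by norm_num, by norm_num⟩
  have hb0 : ∀ x, x ∉ Set.Ioo (-1 / 8 : ℝ) (1 / 8) → b x = 0 := by
    intro x hx
    refine b.zero_of_le_dist ?_
    rw [Real.dist_eq, sub_zero, le_abs]
    simp only [Set.mem_Ioo, not_and_or, not_lt] at hx
    rcases hx with h | h
    · right; change (1 : ℝ) / 8 ≤ _; linarith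
    · left; exact h
  set φ : ℝ → ℝ := fun x => b (x - 1 / 4) - b (x - 3 / 4) with hφ
  have hsm : ContDiff ℝ ∞ φ :=
    (b.contDiff.comp (contDiff_id.sub contDiff_const)).sub
      (b.contDiff.comp (contDiff_id.sub contDiff_const))
  have hsupp : ∀ x, x ∉ Set.Icc (1 / 8 : ℝ) (7 / 8) → φ x = 0 := by
    intro x hx
    simp only [Set.mem_Icc, not_and_or, not_le] at hx
    have h1 : b (x - 1 / 4) = 0 := hb0 _ fun h => by
      rcases hx with h' | h' <;> linarith [h.1, h.2]
    have h2 : b (x - 3 / 4) = 0 := hb0 _ fun h => by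
      rcases hx with h' | h' <;> linarith [h.1, h.2]
    simp only [hφ, h1, h2, sub_self]
  have hts : tsupport φ ⊆ Set.Icc (1 / 8 : ℝ) (7 / 8) :=
    closure_minimal (fun x hx => by_contra fun h => hx (hsupp x h)) isClosed_Icc
  have hcs : HasCompactSupport φ := isCompact_Icc.of_isClosed_subset (isClosed_tsupport _) hts
  have hd : ∀ r, Function.support (iteratedDeriv r φ) ⊆ tsupport φ := by
    intro r x hx
    refine support_iteratedFDeriv_subset (𝕜 := ℝ) r (f := φ) ?_
    simp only [Function.mem_support] at hx ⊢
    contrapose! hx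
    rw [iteratedDeriv_eq_iteratedFDeriv, hx]
    rfl
  have hIoo : Set.Icc (1 / 8 : ℝ) (7 / 8) ⊆ Set.Ioo 0 1 := fun x hx =>
    ⟨by linarith [hx.1], by linarith [hx.2]⟩
  refine ⟨φ, hsm, fun x hx => hsupp x fun h => hx (hIoo h),
    fun r x hx => by_contra fun h => hx (hIoo (hts (hd r h))), ?_, ?_, ?_, ?_⟩
  · intro x
    have := b.nonneg (x := x - 1 / 4)
    have := b.le_one (x := x - 1 / 4)
    have := b.nonneg (x := x - 3 / 4)
    have := b.le_one (x := x - 3 / 4)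
    rw [abs_le]
    constructor <;> simp only [hφ] <;> linarith
  · have hi : Integrable b := b.continuous.integrable_of_hasCompactSupport b.hasCompactSupport
    simp only [hφ]
    rw [integral_sub (hi.comp_sub_right _) (hi.comp_sub_right _),
      integral_sub_right_eq_self (fun x => b x), integral_sub_right_eq_self (fun x => b x), sub_self]
  · refine Continuous.integral_pos_of_hasCompactSupport_nonneg_nonzero (x := 1 / 4)
      (hsm.continuous.pow 2) ?_ (fun x => sq_nonneg _) ?_
    · exact hcs.comp_left (g := fun t : ℝ => t ^ 2) (by simp)
    · have h1 : b (1 / 4 - 1 / 4 : ℝ) = 1 :=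
        b.one_of_mem_closedBall (by simp [b])
      have h2 : b (1 / 4 - 3 / 4 : ℝ) = 0 := hb0 _ fun h => by linarith [h.1]
      simp only [hφ]
      rw [h1, h2]
      norm_num
  · intro r
    have hc : Continuous (iteratedDeriv r φ) :=
      hsm.continuous_iteratedDeriv r (by exact_mod_cast le_top)
    have hk : HasCompactSupport (iteratedDeriv r φ) :=
      hcs.mono' (hd r)
    obtain ⟨B, hB⟩ := hk.exists_bound_of_continuous hc
    exact ⟨B, hB⟩

/-- The `r`-th difference of a function is controlled by its `r`-th derivative. -/
lemma abs_fwdDiff_iter_le {B : ℝ} (h : ℝ) (r : ℕ) (F : ℝ → ℝ) (hF : ContDiff ℝ r F)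
    (hB : ∀ x, |iteratedDeriv r F x| ≤ B) (x : ℝ) : |(fwdDiff h)^[r] F x| ≤ B * |h| ^ r := by
  induction r generalizing F B with
  | zero => simpa using hB x
  | succ r ih =>
    rw [Function.iterate_succ_apply]
    have hF' : ContDiff ℝ r F := hF.of_le (by exact_mod_cast Nat.le_succ r)
    have hsh : ContDiff ℝ r fun y => F (y + h) := hF'.comp (contDiff_id.add contDiff_const)
    have hd : ∀ y, iteratedDeriv r (fwdDiff h F) y = iteratedDeriv r F (y + h) - iteratedDeriv r F y := by
      intro y
      have : fwdDiff h F = fun y => F (y + h) - F y := rfl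
      rw [this, iteratedDeriv_fun_sub hsh.contDiffAt hF'.contDiffAt, iteratedDeriv_comp_add_const]
    have hdiff : Differentiable ℝ (iteratedDeriv r F) :=
      hF.differentiable_iteratedDeriv r (by exact_mod_cast Nat.lt_succ_self r)
    -- By the mean value inequality one difference trades one derivative for a factor `|h|`.
    have hmv : ∀ y, |iteratedDeriv r (fwdDiff h F) y| ≤ B * |h| := by
      intro y
      rw [hd]
      have := Convex.norm_image_sub_le_of_norm_deriv_le (f := iteratedDeriv r F) (C := B)
        (s := Set.univ) (x := y) (y := y + h) (fun z _ => hdiff z)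
        (fun z _ => by rw [← iteratedDeriv_succ]; exact hB z) convex_univ trivial trivial
      simpa using this
    refine (ih (fwdDiff h F) (hsh.sub hF') hmv).trans_eq ?_
    ring

lemma abs_fwdDiff_iter_le_two_pow {B : ℝ} (h : ℝ) (r : ℕ) (F : ℝ → ℝ)
    (hB : ∀ x, |F x| ≤ B) (x : ℝ) : |(fwdDiff h)^[r] F x| ≤ 2 ^ r * B := by
  induction r generalizing F B with
  | zero => simpa using hB x
  | succ r ih =>
    rw [Function.iterate_succ_apply]
    refine (ih (B := 2 * B) (fwdDiff h F) fun y => ?_).trans_eq (by ring)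
    have h1 := abs_le.1 (hB (y + h))
    have h2 := abs_le.1 (hB y)
    rw [fwdDiff, abs_le]
    constructor <;> linarith

lemma fwdDiff_iter_eq_sum_real (h : ℝ) (r : ℕ) (F : ℝ → ℝ) (x : ℝ) :
    (fwdDiff h)^[r] F x = ∑ k ∈ Finset.range (r + 1),
      (-1 : ℝ) ^ (r - k) * (r.choose k : ℝ) * F (x + k * h) := by
  rw [fwdDiff_iter_eq_sum_shift]
  refine Finset.sum_congr rfl fun k _ => ?_
  simp

/-- Functions on the unit cells of the integer grid do not interact. -/
lemma sum_tile (S : Finset (ℤ × ℤ)) (P Q : ℝ → ℝ) (hP : ∀ x, x ∉ Set.Ioo (0 : ℝ) 1 → P x = 0)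
    (hQ : ∀ x, x ∉ Set.Ioo (0 : ℝ) 1 → Q x = 0) (u v : ℝ) :
    ∑ k ∈ S, P (u - k.1) * Q (v - k.2) =
      if (⌊u⌋, ⌊v⌋) ∈ S then P (Int.fract u) * Q (Int.fract v) else 0 := by
  -- Only the translate by `⌊u⌋` can be nonzero at `u`. On the grid lines all translates vanish,
  -- because the profile is zero outside the open interval.
  have key : ∀ (P : ℝ → ℝ), (∀ x, x ∉ Set.Ioo (0 : ℝ) 1 → P x = 0) → ∀ (u : ℝ) (k : ℤ),
      k ≠ ⌊u⌋ → P (u - k) = 0 := by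
    intro P hP u k hk
    refine hP _ fun h => hk ?_
    rw [eq_comm, Int.floor_eq_iff]
    exact ⟨by linarith [h.1], by linarith [h.2]⟩
  have hne : ∀ k : ℤ × ℤ, k ≠ (⌊u⌋, ⌊v⌋) → P (u - k.1) * Q (v - k.2) = 0 := by
    intro k hk
    by_cases h1 : k.1 = ⌊u⌋
    · rw [key Q hQ v k.2 fun h2 => hk (Prod.ext h1 h2), mul_zero]
    · rw [key P hP u k.1 h1, zero_mul]
  split_ifs with h
  · rw [Finset.sum_eq_single_of_mem _ h fun k _ hk => hne k hk]
    rfl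
  · exact Finset.sum_eq_zero fun k hk => hne k fun e => h (e ▸ hk)

lemma abs_sum_tile_le (S : Finset (ℤ × ℤ)) (P Q : ℝ → ℝ) (B B' : ℝ)
    (hP : ∀ x, x ∉ Set.Ioo (0 : ℝ) 1 → P x = 0) (hQ : ∀ x, x ∉ Set.Ioo (0 : ℝ) 1 → Q x = 0)
    (hPB : ∀ x, |P x| ≤ B) (hQB : ∀ x, |Q x| ≤ B') (u v : ℝ) :
    |∑ k ∈ S, P (u - k.1) * Q (v - k.2)| ≤ B * B' := by
  have hB := (abs_nonneg _).trans (hPB 0)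
  have hB' := (abs_nonneg _).trans (hQB 0)
  rw [sum_tile S P Q hP hQ]
  split_ifs
  · rw [abs_mul]
    exact mul_le_mul (hPB _) (hQB _) (abs_nonneg _) hB
  · rw [abs_zero]; positivity

end Profile

section MinimaxLowerBound

open TransitionDensity

/-! ### Chains obtained by perturbing an i.i.d. chain -/

section Base

variable {f : ℝ → ℝ} {w : ℝ × ℝ → ℝ}

lemma withDensity_transition (hf : Measurable f) (hf0 : ∀ y, 0 ≤ f y) (hw : Measurable w) (x : ℝ) :
    (volume : Measure ℝ).withDensity (fun y => ENNReal.ofReal (f y * (1 + w (x, y)))) =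
      ((volume : Measure ℝ).withDensity fun y => ENNReal.ofReal (f y)).withDensity
        fun y => ENNReal.ofReal (1 + w (x, y)) := by
  rw [← withDensity_mul _ (by fun_prop) (by fun_prop)]
  congr 1
  ext y
  simp [ENNReal.ofReal_mul (hf0 y)]

lemma isTransitionDensity_mul (hf : Measurable f) (hf0 : ∀ y, 0 ≤ f y) (hw : Measurable w)
    (hwb : ∀ z, |w z| ≤ 1 / 3)
    (hD : IsCouplingDensity (volume.withDensity fun y => ENNReal.ofReal (f y))
      fun z => ENNReal.ofReal (1 + w z)) :
    IsTransitionDensity fun z => f z.2 * (1 + w z) where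
  measurable := by fun_prop
  nonneg z := mul_nonneg (hf0 _) (by linarith [(abs_le.1 (hwb z)).1])
  lintegral_eq_one x := by
    have h := hD.lintegral_right x
    rw [← h]
    have h' := congrArg (fun m : Measure ℝ => m Set.univ) (withDensity_transition hf hf0 hw x)
    simpa using h'

lemma transitionKernel_mul_apply (hf : Measurable f) (hf0 : ∀ y, 0 ≤ f y) (hw : Measurable w)
    (x : ℝ) :
    transitionKernel (fun z => f z.2 * (1 + w z)) x =
      ((volume : Measure ℝ).withDensity fun y => ENNReal.ofReal (f y)).withDensity
        fun y => ENNReal.ofReal (1 + w (x, y)) := by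
  rw [transitionKernel, Kernel.withDensity_apply _ (by
    have : Measurable fun z : ℝ × ℝ => ENNReal.ofReal (f z.2 * (1 + w z)) := by fun_prop
    exact this), Kernel.const_apply]
  exact withDensity_transition hf hf0 hw x

lemma isPositiveRecurrent_mul (hf : Measurable f) (hf0 : ∀ y, 0 ≤ f y) (hw : Measurable w)
    (hwb : ∀ z, |w z| ≤ 1 / 3)
    [hP : IsProbabilityMeasure ((volume : Measure ℝ).withDensity fun y => ENNReal.ofReal (f y))]
    (hD : IsCouplingDensity (volume.withDensity fun y => ENNReal.ofReal (f y))
      fun z => ENNReal.ofReal (1 + w z)) :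
    IsPositiveRecurrent (fun z => f z.2 * (1 + w z))
      (volume.withDensity fun y => ENNReal.ofReal (f y)) where
  irreducible := by
    -- One step suffices: `1 + w ≥ 2/3` makes the kernel dominate `2/3` of the invariant law from
    -- every starting point.
    refine ⟨_, inferInstance, hP.ne_zero, ⟨fun B hB hpos x => ⟨1, ?_⟩⟩⟩
    rw [pow_one, transitionKernel_mul_apply hf hf0 hw, withDensity_apply _ hB]
    calc (0 : ℝ≥0∞) < ENNReal.ofReal (2 / 3) *
          (volume.withDensity fun y => ENNReal.ofReal (f y)) B :=
          ENNReal.mul_pos (by simp) hpos.ne'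
      _ = ∫⁻ _ in B, ENNReal.ofReal (2 / 3) ∂volume.withDensity fun y => ENNReal.ofReal (f y) := by
          rw [setLIntegral_const]
      _ ≤ _ := lintegral_mono fun y => ENNReal.ofReal_le_ofReal
          (by linarith [(abs_le.1 (hwb (x, y))).1])
  prob := hP
  invariant := by
    set μ := (volume : Measure ℝ).withDensity fun y => ENNReal.ofReal (f y) with hμ
    rw [Kernel.Invariant]
    ext B hB
    rw [Measure.bind_apply hB (Kernel.aemeasurable _)]
    simp only [transitionKernel_mul_apply hf hf0 hw, withDensity_apply _ hB, ← hμ]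
    rw [lintegral_lintegral_swap (hD.measurable.aemeasurable)]
    simp [hD.lintegral_left]

lemma chainLaw_mul (hf : Measurable f) (hf0 : ∀ y, 0 ≤ f y) (hw : Measurable w)
    [IsProbabilityMeasure ((volume : Measure ℝ).withDensity fun y => ENNReal.ofReal (f y))]
    (n : ℕ) :
    chainLaw (fun z => f z.2 * (1 + w z)) (volume.withDensity fun y => ENNReal.ofReal (f y)) n =
      (Measure.pi fun _ => volume.withDensity fun y => ENNReal.ofReal (f y)).withDensity
        (pathDensity (fun z => ENNReal.ofReal (1 + w z)) n) := by
  set μ := (volume : Measure ℝ).withDensity fun y => ENNReal.ofReal (f y) with hμ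
  let m : Fin (n + 1) → Measure ℝ := Fin.cons μ fun _ => volume
  -- The initial state already has law `μ`, so its density factor is `1`; each later state absorbs
  -- the factor `f` of the transition into it.
  let g : Fin (n + 1) → ℝ → ℝ≥0∞ := Fin.cons 1 fun _ y => ENNReal.ofReal (f y)
  have hg : ∀ i, Measurable (g i) := by
    refine Fin.cases ?_ fun i => ?_
    · exact measurable_one
    · exact hf.ennreal_ofReal
  have hmg : ∀ i, (m i).withDensity (g i) = μ := by
    refine Fin.cases ?_ fun i => ?_
    · exact withDensity_one
    · rfl
  have : ∀ i, SigmaFinite (m i) := by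
    refine Fin.cases ?_ fun i => ?_
    · exact (inferInstance : SigmaFinite μ)
    · exact (inferInstance : SigmaFinite (volume : Measure ℝ))
  have : ∀ i, SigmaFinite ((m i).withDensity (g i)) := fun i => by
    rw [hmg]; infer_instance
  have h := pi_withDensity_fin m g hg
  simp only [hmg] at h
  have hmeas : Measurable fun x : Fin (n + 1) → ℝ => ∏ i, g i (x i) :=
    Finset.measurable_fun_prod _ fun i _ => (hg i).comp (measurable_pi_apply i)
  rw [h, ← withDensity_mul _ hmeas (measurable_pathDensity (by fun_prop) n)]
  rw [chainLaw]
  congr 1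
  ext x
  simp only [pathDensity, Pi.mul_apply, Fin.prod_univ_succ (fun i => g i (x i))]
  simp [g, ENNReal.ofReal_mul (hf0 _), Finset.prod_mul_distrib]

end Base

/-! ### Integrals over `A` and the choice of the grid shift -/

lemma l2Norm_sq (A : Set (ℝ × ℝ)) (g : ℝ × ℝ → ℝ) :
    l2Norm A g ^ 2 = ∫⁻ z in A, ENNReal.ofReal (g z ^ 2) := by
  have h := eLpNorm_nnreal_pow_eq_lintegral (f := g) (μ := volume.restrict A) (p := 2) (by simp)
  rw [l2Norm, ← ENNReal.rpow_natCast]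
  refine (Eq.trans (by norm_num) h).trans (lintegral_congr fun z => ?_)
  rw [← ofReal_norm, ENNReal.ofReal_rpow_of_nonneg (norm_nonneg _) (by simp)]
  simp

lemma l2Norm_le {A A' : Set (ℝ × ℝ)} (hA' : MeasurableSet A') (hAA' : A' ⊆ A) {g : ℝ × ℝ → ℝ}
    {B : ℝ} (hg : ∀ z ∈ A', |g z| ≤ B) :
    l2Norm A' g ≤ volume A ^ (1 / 2 : ℝ) * ENNReal.ofReal B := by
  have h := eLpNorm_le_of_ae_bound (p := 2) (f := g) (μ := volume.restrict A') (C := B)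
    (ae_restrict_of_forall_mem hA' hg)
  refine h.trans ?_
  simp only [Measure.restrict_apply_univ]
  gcongr
  simpa using ENNReal.rpow_le_rpow (measure_mono hAA') (by norm_num)

/-- The shifted bumps cover a bounded set evenly on average, hence well for a suitable shift. -/
lemma IsProfile.exists_shift {φ : ℝ → ℝ} (hφ : IsProfile φ) {A : Set ℝ} (hA : MeasurableSet A)
    {R h : ℝ} (hh : 0 < h) (hAR : A ⊆ Set.Icc (-R) R) {m : ℤ} (hm : R / h + 2 ≤ m) :
    ∃ s ∈ Set.Icc (0 : ℝ) 1, ENNReal.ofReal (∫ x, φ x ^ 2) * volume A ≤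
      ∫⁻ x in A, ENNReal.ofReal (∑ j ∈ Finset.Icc (-m) m, φ (x / h - s - j) ^ 2) := by
  have hc := hφ.contDiff.continuous
  have hcs : HasCompactSupport φ := HasCompactSupport.intro isCompact_Icc
    fun x hx => hφ.eq_zero x fun h => hx (Set.Ioo_subset_Icc_self h)
  have hint : ∀ u : ℝ, Integrable fun t => φ (u - t) ^ 2 := by
    intro u
    have h1 : HasCompactSupport fun t => φ t ^ 2 :=
      hcs.comp_left (g := fun t : ℝ => t ^ 2) (zero_pow two_ne_zero)
    have h2 : Continuous fun t => φ t ^ 2 := hc.pow 2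
    exact (h2.integrable_of_hasCompactSupport h1).comp_sub_left u
  -- Integrating over a unit of shifts and summing over integer translates unfolds to the integral
  -- over the whole line. The margin `2` in `hm`, for shift and cell width, ensures that the
  -- truncated sum misses no nonzero term.
  have hcell : ∀ u ∈ Set.Icc (-(R / h)) (R / h), ∫⁻ s in Set.Ioc (0 : ℝ) 1,
      ENNReal.ofReal (∑ j ∈ Finset.Icc (-m) m, φ (u - s - j) ^ 2) =
        ENNReal.ofReal (∫ x, φ x ^ 2) := by
    intro u hu
    have h1 := (hint u).hasSum_intervalIntegral_comp_add_int
    have h2 : ∀ j ∉ Finset.Icc (-m) m, ∫ s in (0 : ℝ)..1, φ (u - (s + (j : ℤ))) ^ 2 = 0 := by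
      intro j hj
      rw [intervalIntegral.integral_congr (g := fun _ => 0), intervalIntegral.integral_zero]
      intro s hs
      rw [Set.uIcc_of_le zero_le_one] at hs
      have hz : φ (u - (s + j)) = 0 := by
        refine hφ.eq_zero _ fun h3 => hj ?_
        rw [Finset.mem_Icc]
        constructor
        · have : (-m : ℝ) ≤ j := by linarith [h3.1, h3.2, hu.1, hu.2, hs.1, hs.2]
          exact_mod_cast this
        · have : (j : ℝ) ≤ m := by linarith [h3.1, h3.2, hu.1, hu.2, hs.1, hs.2]
          exact_mod_cast this
      simp [hz]
    have h3 := h1.unique (hasSum_sum_of_ne_finset_zero h2)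
    rw [integral_sub_left_eq_self (fun x => φ x ^ 2)] at h3
    have hcj : ∀ j : ℤ, Continuous fun s => φ (u - s - j) ^ 2 := fun j => by fun_prop
    rw [h3, ← ofReal_integral_eq_lintegral_ofReal]
    · rw [← intervalIntegral.integral_of_le zero_le_one,
        intervalIntegral.integral_finsetSum fun j _ => (hcj j).intervalIntegrable _ _]
      simp only [sub_sub]
    · exact (continuous_finsetSum _ fun j _ => hcj j).integrableOn_Ioc
    · exact Eventually.of_forall fun s => Finset.sum_nonneg fun j _ => sq_nonneg _
  have : IsProbabilityMeasure (volume.restrict (Set.Ioc (0 : ℝ) 1)) := ⟨by simp⟩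
  set F : ℝ → ℝ≥0∞ := fun s =>
    ∫⁻ x in A, ENNReal.ofReal (∑ j ∈ Finset.Icc (-m) m, φ (x / h - s - j) ^ 2) with hF
  have hmeas : Measurable fun q : ℝ × ℝ =>
      ENNReal.ofReal (∑ j ∈ Finset.Icc (-m) m, φ (q.2 / h - q.1 - j) ^ 2) := by
    refine Continuous.measurable ?_ |>.ennreal_ofReal
    fun_prop
  have havg : ∫⁻ s in Set.Ioc (0 : ℝ) 1, F s = ENNReal.ofReal (∫ x, φ x ^ 2) * volume A := by
    rw [hF, lintegral_lintegral_swap hmeas.aemeasurable, ← setLIntegral_const]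
    refine setLIntegral_congr_fun hA fun x hx => hcell (x / h) ?_
    have := hAR hx
    rw [← neg_div]
    exact ⟨by gcongr; exact this.1, by gcongr; exact this.2⟩
  have hfin : volume A ≠ ∞ := ((measure_mono hAR).trans_lt (by simp)).ne
  -- Some shift does at least as well as the average.
  obtain ⟨s, hs, hle⟩ := exists_notMem_null_lintegral_le (f := F)
    (μ := volume.restrict (Set.Ioc (0 : ℝ) 1)) (N := (Set.Ioc (0 : ℝ) 1)ᶜ)
    (by rw [havg]; exact ENNReal.mul_ne_top ENNReal.ofReal_ne_top hfin)
    (by rw [Measure.restrict_apply measurableSet_Ioc.compl]; simp)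
  exact ⟨s, Set.Ioc_subset_Icc_self (not_not.1 hs), havg ▸ hle⟩

/-! ### Grid bumps and their Besov norm -/

/-- The sum of the rescaled and shifted product bumps over the cells `S` of a grid. -/
noncomputable def gridBump (φ : ℝ → ℝ) (h s : Fin 2 → ℝ) (S : Finset (ℤ × ℤ)) (z : ℝ × ℝ) : ℝ :=
  ∑ k ∈ S, φ (z.1 / h 0 - s 0 - k.1) * φ (z.2 / h 1 - s 1 - k.2)

/-- The `r`-th difference kills constants, so only the perturbation contributes to the moduli of
smoothness. -/
lemma sum_alternating_choose_mul_const {r : ℕ} (hr : 0 < r) (c : ℝ) :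
    ∑ k ∈ Finset.range (r + 1), (-1 : ℝ) ^ (r - k) * (r.choose k : ℝ) * c = 0 := by
  have h := abs_fwdDiff_iter_le (B := 0) 1 r (fun _ => c) contDiff_const (fun x => by
    rw [iteratedDeriv_const]; simp [hr.ne']) 0
  rw [zero_mul, abs_nonpos_iff, fwdDiff_iter_eq_sum_real] at h
  exact h

/-- Oscillation at scale `h` costs `h ^ (-α)`, uniformly in `t`. For `t ≥ h` the trivial bound `2 ^
r` suffices; for `t ≤ h` the derivative bound leaves `(t / h) ^ (r - α) ≤ 1`, which is where `α < r`
enters. -/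
lemma rpow_neg_mul_min_le {α h t B : ℝ} {r : ℕ} (hα : 0 < α) (hr : α < r) (hh : 0 < h)
    (ht : 0 < t) (hB : 0 ≤ B) :
    t ^ (-α) * min (2 ^ r) (B * (t / h) ^ r) ≤ (2 ^ r + B) * h ^ (-α) := by
  have hp : 0 < h ^ (-α) := Real.rpow_pos_of_pos hh _
  have hq : 0 < t ^ (-α) := Real.rpow_pos_of_pos ht _
  rcases le_total h t with hht | hht
  · calc t ^ (-α) * min (2 ^ r) (B * (t / h) ^ r) ≤ h ^ (-α) * 2 ^ r := by
          gcongr ?_ * ?_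
          · exact Real.rpow_le_rpow_of_nonpos hh hht (by linarith)
          · exact min_le_left _ _
      _ ≤ _ := by nlinarith
  · have hq1 : t / h ≤ 1 := (div_le_one hh).2 hht
    have hq0 : 0 < t / h := div_pos ht hh
    have e : t ^ (-α) = (t / h) ^ (-α) * h ^ (-α) := by
      rw [← Real.mul_rpow hq0.le hh.le, div_mul_cancel₀ _ hh.ne']
    calc t ^ (-α) * min (2 ^ r) (B * (t / h) ^ r) ≤ t ^ (-α) * (B * (t / h) ^ r) := by
          gcongr
          exact min_le_right _ _
      _ = B * ((t / h) ^ ((r : ℝ) - α)) * h ^ (-α) := by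
          rw [e, sub_eq_add_neg, Real.rpow_add hq0, Real.rpow_natCast]; ring
      _ ≤ B * 1 * h ^ (-α) := by
          gcongr
          exact Real.rpow_le_one hq0.le hq1 (by linarith)
      _ ≤ _ := by nlinarith [pow_pos (two_pos : (0 : ℝ) < 2) r]

lemma isClosed_diffDomain {A : Set (ℝ × ℝ)} (hA : IsClosed A) (i : Fin 2) (r : ℕ) (h : ℝ) :
    IsClosed (diffDomain A i r h) := by
  simp only [diffDomain, Set.ofPred_forall]
  exact isClosed_iInter fun k => isClosed_iInter fun _ =>
    hA.preimage (continuous_id.add continuous_const)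

lemma diffDomain_subset (A : Set (ℝ × ℝ)) (i : Fin 2) (r : ℕ) (h : ℝ) :
    diffDomain A i r h ⊆ A := fun z hz => by
  simpa using hz 0 (Nat.zero_le _)

namespace IsProfile

variable {φ : ℝ → ℝ}

lemma abs_gridBump_le (hφ : IsProfile φ) (h s : Fin 2 → ℝ) (S : Finset (ℤ × ℤ)) (z : ℝ × ℝ) :
    |gridBump φ h s S z| ≤ 1 := by
  simpa only [gridBump, mul_one] using abs_sum_tile_le S φ φ 1 1 hφ.eq_zero hφ.eq_zero hφ.abs_le_one
    hφ.abs_le_one (z.1 / h 0 - s 0) (z.2 / h 1 - s 1)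

lemma continuous_gridBump (hφ : IsProfile φ) (h s : Fin 2 → ℝ) (S : Finset (ℤ × ℤ)) :
    Continuous (gridBump φ h s S) := by
  have := hφ.contDiff.continuous
  unfold gridBump
  fun_prop

lemma measurable_gridBump (hφ : IsProfile φ) (h s : Fin 2 → ℝ) (S : Finset (ℤ × ℤ)) :
    Measurable (gridBump φ h s S) := (hφ.continuous_gridBump h s S).measurable

/-- With `v` frozen this is a difference in one variable. The cells do not overlap, so neither the
function nor its `r`-th derivative grows with `S`. -/
lemma abs_sum_tile_diff_le (hφ : IsProfile φ) (S : Finset (ℤ × ℤ)) (r : ℕ) {B : ℝ}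
    (hB : ∀ x, |iteratedDeriv r φ x| ≤ B) (u v η : ℝ) :
    |∑ j ∈ Finset.range (r + 1), (-1 : ℝ) ^ (r - j) * (r.choose j : ℝ) *
      ∑ k ∈ S, φ (u + j * η - k.1) * φ (v - k.2)| ≤ min (2 ^ r) (B * |η| ^ r) := by
  have hsm : ContDiff ℝ r φ := hφ.contDiff.of_le (by exact_mod_cast le_top)
  have hk : ∀ k : ℤ × ℤ, ContDiff ℝ r fun x => φ (x - k.1) := fun k =>
    hsm.comp (contDiff_id.sub contDiff_const)
  set F : ℝ → ℝ := fun x => ∑ k ∈ S, φ (x - k.1) * φ (v - k.2) with hF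
  have hFs : ContDiff ℝ r F := ContDiff.sum fun k _ => (hk k).mul contDiff_const
  have hd : ∀ x, iteratedDeriv r F x = ∑ k ∈ S, iteratedDeriv r φ (x - k.1) * φ (v - k.2) := by
    intro x
    rw [hF, iteratedDeriv_fun_sum fun k _ => ((hk k).mul contDiff_const).contDiffAt]
    refine Finset.sum_congr rfl fun k _ => ?_
    simp_rw [mul_comm _ (φ (v - k.2))]
    rw [iteratedDeriv_const_mul_field, iteratedDeriv_comp_sub_const]
  change |∑ j ∈ Finset.range (r + 1), (-1 : ℝ) ^ (r - j) * (r.choose j : ℝ) * F (u + j * η)| ≤ _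
  rw [← fwdDiff_iter_eq_sum_real]
  refine le_min ?_ ?_
  · refine (abs_fwdDiff_iter_le_two_pow (B := 1) η r F (fun x => ?_) u).trans_eq (mul_one _)
    simpa using abs_sum_tile_le S φ φ 1 1 hφ.eq_zero hφ.eq_zero hφ.abs_le_one hφ.abs_le_one x v
  · refine abs_fwdDiff_iter_le η r F hFs (fun x => ?_) u
    rw [hd]
    simpa using abs_sum_tile_le S (iteratedDeriv r φ) φ B 1 (hφ.iteratedDeriv_eq_zero r)
      hφ.eq_zero hB hφ.abs_le_one x v

lemma abs_diff_gridBump_le (hφ : IsProfile φ) (h s : Fin 2 → ℝ) (hh : ∀ i, 0 < h i)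
    (S : Finset (ℤ × ℤ)) (i : Fin 2) (r : ℕ) {B : ℝ} (hB : ∀ x, |iteratedDeriv r φ x| ≤ B)
    (η : ℝ) (z : ℝ × ℝ) :
    |∑ j ∈ Finset.range (r + 1), (-1 : ℝ) ^ (r - j) * (r.choose j : ℝ) *
      gridBump φ h s S (z + ((j : ℝ) * η) • basisVec i)| ≤
        min (2 ^ r) (B * (|η| / h i) ^ r) := by
  have hη : |η| / h i = |η / h i| := by rw [abs_div, abs_of_pos (hh i)]
  rw [hη]
  fin_cases i
  · convert hφ.abs_sum_tile_diff_le S r hB (z.1 / h 0 - s 0) (z.2 / h 1 - s 1) (η / h 0) using 5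
      with j _
    · simp only [gridBump]
      refine Finset.sum_congr rfl fun k _ => ?_
      simp only [basisVec, Fin.zero_eta, Matrix.cons_val_zero, Prod.fst_add, Prod.smul_fst,
        Prod.snd_add, Prod.smul_snd, smul_eq_mul, mul_one, mul_zero, add_zero]
      congr 2
      ring
    · rfl
  -- The second direction reduces to the first by transposing the grid.
  · convert hφ.abs_sum_tile_diff_le (S.map (Equiv.prodComm ℤ ℤ).toEmbedding) r hB
      (z.2 / h 1 - s 1) (z.1 / h 0 - s 0) (η / h 1) using 5 with j _
    · simp only [gridBump, Finset.sum_map]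
      refine Finset.sum_congr rfl fun k _ => ?_
      simp only [basisVec, Fin.mk_one, Matrix.cons_val_one, Matrix.cons_val_fin_one, Prod.fst_add,
        Prod.smul_fst, Prod.snd_add, Prod.smul_snd, smul_eq_mul, mul_one, mul_zero, add_zero,
        Equiv.coe_toEmbedding, Equiv.prodComm_apply, Prod.fst_swap, Prod.snd_swap]
      rw [mul_comm]
      congr 2
      ring
    · rfl

/-- The Besov norm of a constant with a small oscillating perturbation. -/
lemma besovNorm_le (hφ : IsProfile φ) {A : Set (ℝ × ℝ)} (hA : IsClosed A) {f : ℝ → ℝ} {c : ℝ}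
    (hc : 0 ≤ c) (hf : ∀ z ∈ A, f z.2 = c) (h s : Fin 2 → ℝ) (hh : ∀ i, 0 < h i)
    (S : Finset (ℤ × ℤ)) (α : Fin 2 → ℝ) (hα : ∀ i, 0 < α i) (r : Fin 2 → ℕ)
    (hr : ∀ i, α i < r i) {B : Fin 2 → ℝ} (hB : ∀ i x, |iteratedDeriv (r i) φ x| ≤ B i) {a : ℝ}
    (ha : 0 ≤ a) (ha3 : a ≤ 1 / 3) (hab : ∀ i, a * ((2 ^ r i + B i) * h i ^ (-α i)) ≤ 1 / 3) :
    besovNorm A α r (fun z => f z.2 * (1 + a * gridBump φ h s S z)) ≤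
      volume A ^ (1 / 2 : ℝ) * ENNReal.ofReal (2 * c) := by
  set g : ℝ × ℝ → ℝ := fun z => f z.2 * (1 + a * gridBump φ h s S z) with hg
  have h1 : l2Norm A g ≤ volume A ^ (1 / 2 : ℝ) * ENNReal.ofReal (c * (4 / 3)) := by
    refine l2Norm_le hA.measurableSet subset_rfl fun z hz => ?_
    have hb := abs_le.1 (hφ.abs_gridBump_le h s S z)
    rw [hg]
    simp only [hf z hz]
    rw [abs_mul, abs_of_nonneg hc]
    gcongr
    rw [abs_le]
    constructor <;> nlinarith
  have h2 : ∀ t : ℝ, 0 < t → ∀ i, ENNReal.ofReal (t ^ (-α i)) * modulus A i (r i) g t ≤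
      volume A ^ (1 / 2 : ℝ) * ENNReal.ofReal (c * (1 / 3)) := by
    intro t ht i
    have hri : 0 < r i := by exact_mod_cast (hα i).trans (hr i)
    have hBi : 0 ≤ B i := (abs_nonneg _).trans (hB i 0)
    set m := min (2 ^ r i) (B i * (t / h i) ^ r i)
    have hmod : modulus A i (r i) g t ≤ volume A ^ (1 / 2 : ℝ) * ENNReal.ofReal (c * (a * m)) := by
      refine iSup₂_le fun η hη => l2Norm_le (isClosed_diffDomain hA i _ η).measurableSet
        (diffDomain_subset A i _ η) fun z hz => ?_
      -- Every point of the difference stencil lies in `A`, where `f` is the constant `c`; jumps of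
      -- `f` outside `A` are never seen.
      have hd : diffOp i (r i) η g z = c * (a * ∑ j ∈ Finset.range (r i + 1),
          (-1 : ℝ) ^ (r i - j) * ((r i).choose j : ℝ) *
            gridBump φ h s S (z + ((j : ℝ) * η) • basisVec i)) := by
        rw [diffOp, ← add_zero (c * _), ← sum_alternating_choose_mul_const hri c, Finset.mul_sum,
          Finset.mul_sum, ← Finset.sum_add_distrib]
        refine Finset.sum_congr rfl fun j hj => ?_
        rw [hg]
        simp only [hf _ (hz j (Finset.mem_range_succ_iff.1 hj))]
        ring
      rw [hd, abs_mul, abs_mul, abs_of_nonneg hc, abs_of_nonneg ha]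
      gcongr
      refine (hφ.abs_diff_gridBump_le h s hh S i (r i) (hB i) η z).trans ?_
      refine min_le_min_left _ ?_
      have := hh i
      gcongr
    calc _ ≤ ENNReal.ofReal (t ^ (-α i)) * (volume A ^ (1 / 2 : ℝ) *
          ENNReal.ofReal (c * (a * m))) := by gcongr
      _ = volume A ^ (1 / 2 : ℝ) * ENNReal.ofReal (c * (a * (t ^ (-α i) * m))) := by
          rw [mul_left_comm, ← ENNReal.ofReal_mul (by positivity)]
          congr 2
          ring
      _ ≤ _ := by
          gcongr
          refine le_trans ?_ (hab i)
          exact mul_le_mul_of_nonneg_left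
            (rpow_neg_mul_min_le (hα i) (hr i) (hh i) ht hBi) ha
  -- The factor `2` in the bound is `4/3 + 1/3 + 1/3`.
  calc besovNorm A α r g ≤ volume A ^ (1 / 2 : ℝ) * ENNReal.ofReal (c * (4 / 3)) +
        ∑ _ : Fin 2, volume A ^ (1 / 2 : ℝ) * ENNReal.ofReal (c * (1 / 3)) := by
        refine add_le_add h1 (iSup₂_le fun t ht => Finset.sum_le_sum fun i _ => h2 t ht i)
    _ = _ := by
        rw [Fin.sum_univ_two, ← mul_add, ← mul_add, ← ENNReal.ofReal_add (by positivity)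
          (by positivity), ← ENNReal.ofReal_add (by positivity) (by positivity)]
        congr 2
        ring

end IsProfile

/-! ### The uniform base law and its perturbations -/

/-- The uniform density on `[-M, M]`. -/
noncomputable def uniformDensity (M : ℝ) : ℝ → ℝ := (Set.Icc (-M) M).indicator fun _ => 1 / (2 * M)

/-- The uniform distribution on `[-M, M]`. -/
noncomputable def uniformLaw (M : ℝ) : Measure ℝ :=
  volume.withDensity fun y => ENNReal.ofReal (uniformDensity M y)

lemma measurable_uniformDensity (M : ℝ) : Measurable (uniformDensity M) :=
  measurable_const.indicator measurableSet_Icc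

lemma uniformDensity_nonneg {M : ℝ} (hM : 0 < M) (y : ℝ) : 0 ≤ uniformDensity M y :=
  Set.indicator_nonneg (fun _ _ => by positivity) y

lemma uniformLaw_eq (M : ℝ) :
    uniformLaw M = ENNReal.ofReal (1 / (2 * M)) • volume.restrict (Set.Icc (-M) M) := by
  have : (fun y => ENNReal.ofReal (uniformDensity M y)) =
      (Set.Icc (-M) M).indicator fun _ => ENNReal.ofReal (1 / (2 * M)) := by
    ext y
    by_cases hy : y ∈ Set.Icc (-M) M <;> simp [uniformDensity, hy]
  rw [uniformLaw, this, withDensity_indicator measurableSet_Icc, withDensity_const]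

lemma isProbabilityMeasure_uniformLaw {M : ℝ} (hM : 0 < M) :
    IsProbabilityMeasure (uniformLaw M) := ⟨by
  rw [uniformLaw_eq]
  simp only [Measure.smul_apply, Measure.restrict_apply_univ, Real.volume_Icc, smul_eq_mul]
  rw [← ENNReal.ofReal_mul (by positivity)]
  rw [ENNReal.ofReal_eq_one]
  field_simp
  ring⟩

namespace IsProfile

variable {φ : ℝ → ℝ}

/-- The condition `hM` keeps the whole cell inside `[-M, M]`, so the uniform integral is a multiple
of the Lebesgue integral of the mean-zero profile. -/
lemma integral_cell (hφ : IsProfile φ) {M h s : ℝ} (hh : 0 < h) (hs : s ∈ Set.Icc (0 : ℝ) 1)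
    {m j : ℤ} (hj : j ∈ Finset.Icc (-m) m) (hM : h * (m + 2) ≤ M) :
    ∫ y, φ (y / h - s - j) ∂uniformLaw M = 0 := by
  rw [Finset.mem_Icc] at hj
  have hj1 : (-m : ℝ) ≤ j := by exact_mod_cast hj.1
  have hj2 : (j : ℝ) ≤ m := by exact_mod_cast hj.2
  rw [uniformLaw_eq, integral_smul_measure, setIntegral_eq_integral_of_forall_compl_eq_zero]
  · have h1 := Measure.integral_comp_div (fun y => φ (y - s - j)) h
    simp only [sub_sub] at h1 ⊢
    rw [h1, integral_sub_right_eq_self φ, hφ.integral_eq_zero]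
    simp
  · intro y hy
    refine hφ.eq_zero _ fun h2 => hy ?_
    have e : y = h * (y / h) := by field_simp
    have h3 : -(m + 2 : ℝ) ≤ y / h := by linarith [h2.1, hs.1]
    have h4 : y / h ≤ m + 2 := by linarith [h2.2, hs.2]
    have h5 := mul_le_mul_of_nonneg_left h3 hh.le
    have h6 := mul_le_mul_of_nonneg_left h4 hh.le
    constructor <;> linarith

lemma lintegral_cell_sq_le (hφ : IsProfile φ) {M h : ℝ} (hh : 0 < h) (s : ℝ) (j : ℤ) :
    ∫⁻ y, ENNReal.ofReal (φ (y / h - s - j) ^ 2) ∂uniformLaw M ≤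
      ENNReal.ofReal (1 / (2 * M)) * ENNReal.ofReal h := by
  rw [uniformLaw_eq, lintegral_smul_measure, smul_eq_mul]
  gcongr
  refine (setLIntegral_le_lintegral _ _).trans ?_
  calc _ ≤ ∫⁻ y, (Set.Ioo (h * (s + j)) (h * (s + j + 1))).indicator 1 y := by
        refine lintegral_mono fun y => ?_
        by_cases hy : y ∈ Set.Ioo (h * (s + j)) (h * (s + j + 1))
        · rw [Set.indicator_of_mem hy, Pi.one_apply]
          refine ENNReal.ofReal_le_one.2 ?_
          rw [sq_le_one_iff_abs_le_one]
          exact hφ.abs_le_one _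
        · rw [hφ.eq_zero (y / h - s - j) fun h1 => hy ?_]
          · simp
          · have h2 : s + j < y / h := by linarith [h1.1]
            have h3 : y / h < s + j + 1 := by linarith [h1.2]
            rw [lt_div_iff₀ hh] at h2
            rw [div_lt_iff₀ hh] at h3
            constructor <;> linarith
    _ = _ := by
        rw [lintegral_indicator_one measurableSet_Ioo, Real.volume_Ioo]
        congr 1
        ring

end IsProfile

lemma lintegral_one_add_eq_one {μ : Measure ℝ} [IsProbabilityMeasure μ] {v : ℝ → ℝ}
    (hv : Continuous v) (hvb : ∀ y, |v y| ≤ 1 / 3) (h0 : ∫ y, v y ∂μ = 0) :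
    ∫⁻ y, ENNReal.ofReal (1 + v y) ∂μ = 1 := by
  have hi : Integrable v μ := Integrable.of_bound hv.aestronglyMeasurable (1 / 3)
    (Eventually.of_forall hvb)
  have hi' : Integrable (fun y => 1 + v y) μ := (integrable_const 1).add hi
  rw [← ofReal_integral_eq_lintegral_ofReal hi' (Eventually.of_forall fun y => by
      have := (abs_le.1 (hvb y)).1
      simp only [Pi.zero_apply]; linarith),
    integral_add (integrable_const 1) hi, h0]
  simp

namespace IsProfile

variable {φ : ℝ → ℝ}

/-- Each term of the perturbation is a product of two mean-zero factors, so it vanishes when either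
variable is integrated out. -/
lemma isCouplingDensity (hφ : IsProfile φ) {M : ℝ} (hM0 : 0 < M) {h s : Fin 2 → ℝ}
    (hh : ∀ i, 0 < h i) (hs : ∀ i, s i ∈ Set.Icc (0 : ℝ) 1) {m : Fin 2 → ℤ}
    (hM : ∀ i, h i * (m i + 2) ≤ M) {S : Finset (ℤ × ℤ)}
    (hS : S ⊆ Finset.Icc (-m 0) (m 0) ×ˢ Finset.Icc (-m 1) (m 1)) {a : ℝ} (ha : 0 ≤ a)
    (ha3 : a ≤ 1 / 3) :
    IsCouplingDensity (uniformLaw M) fun z => ENNReal.ofReal (1 + a * gridBump φ h s S z) := by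
  have := isProbabilityMeasure_uniformLaw hM0
  have hc := hφ.continuous_gridBump h s S
  have hφc := hφ.contDiff.continuous
  have hb : ∀ z, |a * gridBump φ h s S z| ≤ 1 / 3 := fun z => by
    rw [abs_mul, abs_of_nonneg ha]
    nlinarith [hφ.abs_gridBump_le h s S z, abs_nonneg (gridBump φ h s S z)]
  have hi : ∀ (h s : ℝ) (j : ℤ), Integrable (fun y => φ (y / h - s - j)) (uniformLaw M) :=
    fun h s j => Integrable.of_bound (by
      have : Continuous fun y => φ (y / h - s - j) := by fun_prop
      exact this.aestronglyMeasurable) 1 (Eventually.of_forall fun y => hφ.abs_le_one _)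
  refine ⟨by fun_prop, fun x => ?_, fun y => ?_⟩
  · refine lintegral_one_add_eq_one (v := fun y => a * gridBump φ h s S (x, y)) (by fun_prop)
      (fun y => hb _) ?_
    rw [integral_const_mul]
    simp only [gridBump]
    rw [integral_finsetSum _ fun k _ => (hi _ _ _).const_mul _, Finset.sum_eq_zero, mul_zero]
    intro k hk
    rw [integral_const_mul, hφ.integral_cell (hh 1) (hs 1) (Finset.mem_product.1 (hS hk)).2 (hM 1),
      mul_zero]
  · refine lintegral_one_add_eq_one (v := fun x => a * gridBump φ h s S (x, y)) (by fun_prop)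
      (fun y => hb _) ?_
    rw [integral_const_mul]
    simp only [gridBump]
    rw [integral_finsetSum _ fun k _ => (hi _ _ _).mul_const _, Finset.sum_eq_zero, mul_zero]
    intro k hk
    rw [integral_mul_const, hφ.integral_cell (hh 0) (hs 0) (Finset.mem_product.1 (hS hk)).1 (hM 0),
      zero_mul]

/-- Toggling `k` adds or removes exactly one term, and squaring forgets which. -/
lemma gridBump_sub_symmDiff_sq (h s : Fin 2 → ℝ) (S : Finset (ℤ × ℤ)) (k : ℤ × ℤ) (z : ℝ × ℝ) :
    (gridBump φ h s S z - gridBump φ h s (symmDiff S {k}) z) ^ 2 =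
      φ (z.1 / h 0 - s 0 - k.1) ^ 2 * φ (z.2 / h 1 - s 1 - k.2) ^ 2 := by
  by_cases hk : k ∈ S
  · have : symmDiff S {k} = S.erase k := by
      ext j; simp only [Finset.mem_symmDiff, Finset.mem_singleton, Finset.mem_erase]
      by_cases hj : j = k <;> simp [hj, hk]
    simp only [gridBump]
    rw [this, ← Finset.add_sum_erase _ _ hk]
    ring
  · have : symmDiff S {k} = insert k S := by
      ext j; simp only [Finset.mem_symmDiff, Finset.mem_singleton, Finset.mem_insert]
      by_cases hj : j = k <;> simp [hj, hk]
    simp only [gridBump]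
    rw [this, Finset.sum_insert hk]
    ring

lemma lintegral_gridBump_sub_sq_le (hφ : IsProfile φ) {M : ℝ} (hM0 : 0 < M) {h s : Fin 2 → ℝ}
    (hh : ∀ i, 0 < h i) (S : Finset (ℤ × ℤ)) (k : ℤ × ℤ) (a : ℝ) :
    ∫⁻ z, ENNReal.ofReal ((a * gridBump φ h s S z - a * gridBump φ h s (symmDiff S {k}) z) ^ 2)
      ∂(uniformLaw M).prod (uniformLaw M) ≤
      ENNReal.ofReal (a ^ 2 * ((1 / (2 * M)) ^ 2 * (h 0 * h 1))) := by
  have := isProbabilityMeasure_uniformLaw hM0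
  have hφc := hφ.contDiff.continuous
  have h1 : ∀ z : ℝ × ℝ,
      ENNReal.ofReal ((a * gridBump φ h s S z - a * gridBump φ h s (symmDiff S {k}) z) ^ 2) =
        ENNReal.ofReal (a ^ 2) * (ENNReal.ofReal (φ (z.1 / h 0 - s 0 - k.1) ^ 2) *
          ENNReal.ofReal (φ (z.2 / h 1 - s 1 - k.2) ^ 2)) := by
    intro z
    rw [← mul_sub, mul_pow, gridBump_sub_symmDiff_sq, ENNReal.ofReal_mul (sq_nonneg _),
      ENNReal.ofReal_mul (sq_nonneg _)]
  have h0 := (hh 0).le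
  simp only [h1]
  rw [lintegral_const_mul _ (by fun_prop), lintegral_prod_mul
    (f := fun x => ENNReal.ofReal (φ (x / h 0 - s 0 - k.1) ^ 2))
    (g := fun x => ENNReal.ofReal (φ (x / h 1 - s 1 - k.2) ^ 2)) (by fun_prop) (by fun_prop)]
  calc _ ≤ ENNReal.ofReal (a ^ 2) * ((ENNReal.ofReal (1 / (2 * M)) * ENNReal.ofReal (h 0)) *
        (ENNReal.ofReal (1 / (2 * M)) * ENNReal.ofReal (h 1))) := by
        gcongr
        · exact hφ.lintegral_cell_sq_le (hh 0) _ _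
        · exact hφ.lintegral_cell_sq_le (hh 1) _ _
    _ = _ := by
        rw [← ENNReal.ofReal_mul (by positivity), ← ENNReal.ofReal_mul (by positivity),
          ← ENNReal.ofReal_mul (by positivity), ← ENNReal.ofReal_mul (by positivity)]
        congr 1
        ring

end IsProfile

/-! ### The hypercube of perturbed chains -/

/-- The risk lower bound over the perturbations of the uniform chain. -/
lemma IsProfile.exists_le_risk {φ : ℝ → ℝ} (hφ : IsProfile φ) {M : ℝ} (hM0 : 0 < M)
    {h s : Fin 2 → ℝ} (hh : ∀ i, 0 < h i) (hs : ∀ i, s i ∈ Set.Icc (0 : ℝ) 1) {m : Fin 2 → ℤ}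
    (hM : ∀ i, h i * (m i + 2) ≤ M) {a : ℝ} (ha : 0 ≤ a) (ha3 : a ≤ 1 / 3) {n : ℕ}
    (hn : n * (a ^ 2 * ((1 / (2 * M)) ^ 2 * (h 0 * h 1))) ≤ 1 / 3) {A₁ A₂ : Set ℝ}
    (hA₁ : MeasurableSet A₁) (hA₂ : MeasurableSet A₂)
    (hA₂M : A₂ ⊆ Set.Icc (-M) M) (est : (Fin (n + 1) → ℝ) → ℝ × ℝ → ℝ)
    (hest : Measurable (Function.uncurry est)) :
    ∃ S ⊆ Finset.Icc (-m 0) (m 0) ×ˢ Finset.Icc (-m 1) (m 1),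
      ENNReal.ofReal (1 / 16 * ((1 / (2 * M)) ^ 2 * a ^ 2)) *
        ((∫⁻ x in A₁, ENNReal.ofReal (∑ j ∈ Finset.Icc (-m 0) (m 0),
            φ (x / h 0 - s 0 - j) ^ 2)) *
          ∫⁻ y in A₂, ENNReal.ofReal (∑ j ∈ Finset.Icc (-m 1) (m 1),
            φ (y / h 1 - s 1 - j) ^ 2)) ≤
        risk (A₁ ×ˢ A₂) n est (fun z => uniformDensity M z.2 * (1 + a * gridBump φ h s S z))
          (uniformLaw M) := by
  have := isProbabilityMeasure_uniformLaw hM0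
  have hφc := hφ.contDiff.continuous
  have hfm := measurable_uniformDensity M
  have hGm : ∀ S, Measurable fun z => a * gridBump φ h s S z := fun S =>
    (hφ.measurable_gridBump h s S).const_mul a
  have hwb : ∀ S z, |a * gridBump φ h s S z| ≤ 1 / 3 := fun S z => by
    rw [abs_mul, abs_of_nonneg ha]
    nlinarith [hφ.abs_gridBump_le h s S z, abs_nonneg (gridBump φ h s S z)]
  set K := Finset.Icc (-m 0) (m 0) ×ˢ Finset.Icc (-m 1) (m 1) with hK
  have hD : ∀ S ⊆ K, IsCouplingDensity (uniformLaw M)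
      fun z => ENNReal.ofReal (1 + a * gridBump φ h s S z) := fun S hS =>
    hφ.isCouplingDensity hM0 hh hs hM hS ha ha3
  set p : Finset (ℤ × ℤ) → (Fin (n + 1) → ℝ) → ℝ≥0∞ := fun S =>
    pathDensity (fun z => ENNReal.ofReal (1 + a * gridBump φ h s S z)) n
  have hp : ∀ S, Measurable (p S) := fun S =>
    measurable_pathDensity ((hGm S).const_add 1).ennreal_ofReal n
  set g : Finset (ℤ × ℤ) → ℝ × ℝ → ℝ := fun S z =>
    uniformDensity M z.2 * (1 + a * gridBump φ h s S z) with hg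
  have hgm : ∀ S, Measurable (g S) := fun S =>
    (hfm.comp measurable_snd).mul ((hGm S).const_add 1)
  set U : ℝ × ℝ → ℝ := fun z => ∑ k ∈ K,
    φ (z.1 / h 0 - s 0 - k.1) ^ 2 * φ (z.2 / h 1 - s 1 - k.2) ^ 2 with hU
  have hUm : Measurable U := by
    refine Continuous.measurable ?_
    rw [hU]
    fun_prop
  have hsq : ∀ x, x ∉ Set.Ioo (0 : ℝ) 1 → φ x ^ 2 = 0 := fun x hx => by rw [hφ.eq_zero x hx]; simp
  have hpair : ∀ z, ∃ σ : Finset (ℤ × ℤ) → Finset (ℤ × ℤ), (∀ S ∈ K.powerset, σ S ∈ K.powerset) ∧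
      (∀ S ∈ K.powerset, σ (σ S) = S) ∧ ∀ S ∈ K.powerset,
        ENNReal.ofReal ((uniformDensity M z.2) ^ 2 * a ^ 2 * U z) ≤
            ENNReal.ofReal ((g S z - g (σ S) z) ^ 2) ∧
          ENNReal.ofReal (1 / 4) ≤
            ∫⁻ x, min (p S x) (p (σ S) x) ∂Measure.pi fun _ => uniformLaw M := by
    intro z
    have hUz := sum_tile K (fun x => φ x ^ 2) (fun x => φ x ^ 2) hsq hsq
      (z.1 / h 0 - s 0) (z.2 / h 1 - s 1)
    -- The cell containing `z`: toggling it is the only single-cell change that can be felt at `z`.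
    set k : ℤ × ℤ := (⌊z.1 / h 0 - s 0⌋, ⌊z.2 / h 1 - s 1⌋) with hk
    change U z = _ at hUz
    by_cases hkK : k ∈ K
    · rw [if_pos hkK] at hUz
      have hmem : ∀ S ∈ K.powerset, symmDiff S {k} ∈ K.powerset := by
        intro S hS
        rw [Finset.mem_powerset] at hS ⊢
        intro j hj
        rcases Finset.mem_symmDiff.1 hj with h1 | h1
        · exact hS h1.1
        · rw [Finset.mem_singleton.1 h1.1]; exact hkK
      refine ⟨fun S => symmDiff S {k}, hmem, fun S _ => symmDiff_symmDiff_cancel_right _ _,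
        fun S hS => ⟨ENNReal.ofReal_le_ofReal (le_of_eq ?_), ?_⟩⟩
      · have h1 := IsProfile.gridBump_sub_symmDiff_sq (φ := φ) h s S k z
        have h2 : g S z - g (symmDiff S {k}) z = uniformDensity M z.2 * a *
            (gridBump φ h s S z - gridBump φ h s (symmDiff S {k}) z) := by
          simp only [hg]; ring
        rw [h2, mul_pow, h1, hUz, mul_pow]
        rfl
      · refine le_lintegral_min_pathDensity (hGm _) (hGm _) (hwb _) (hwb _)
          (hD _ (Finset.mem_powerset.1 hS)) (hD _ (Finset.mem_powerset.1 (hmem S hS))) n ?_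
        calc _ ≤ (n : ℝ≥0∞) * ENNReal.ofReal (a ^ 2 * ((1 / (2 * M)) ^ 2 * (h 0 * h 1))) := by
              gcongr
              exact hφ.lintegral_gridBump_sub_sq_le hM0 hh S k a
          _ = ENNReal.ofReal (n * (a ^ 2 * ((1 / (2 * M)) ^ 2 * (h 0 * h 1)))) := by
              rw [ENNReal.ofReal_mul (Nat.cast_nonneg n), ENNReal.ofReal_natCast]
          _ ≤ _ := ENNReal.ofReal_le_ofReal hn
    · rw [if_neg hkK] at hUz
      -- Off the grid the required separation is zero, so pairing each parameter with itself
      -- suffices.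
      refine ⟨id, fun S hS => hS, fun _ _ => rfl, fun S hS => ⟨by simp [hUz], ?_⟩⟩
      simp only [id, min_self]
      rw [lintegral_pathDensity (hD S (Finset.mem_powerset.1 hS))]
      exact ENNReal.ofReal_le_one.2 (by norm_num)
  obtain ⟨S, hS, hle⟩ := assouad (Measure.pi fun _ : Fin (n + 1) => uniformLaw M)
    (volume.restrict (A₁ ×ˢ A₂)) K.powerset ⟨∅, Finset.empty_mem_powerset K⟩ p hp g hgm est hest
    (fun z => ENNReal.ofReal ((uniformDensity M z.2) ^ 2 * a ^ 2 * U z))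
    ((((hfm.comp measurable_snd).pow_const 2).mul_const _).mul hUm).ennreal_ofReal hpair
  refine ⟨S, Finset.mem_powerset.1 hS, le_trans (le_of_eq ?_) (hle.trans_eq ?_)⟩
  -- On `A₂` the base density is constant, so the separation factorizes over the two coordinates.
  · have hsum : ∀ z ∈ A₁ ×ˢ A₂, ENNReal.ofReal ((uniformDensity M z.2) ^ 2 * a ^ 2 * U z) =
        ENNReal.ofReal ((1 / (2 * M)) ^ 2 * a ^ 2) *
          (ENNReal.ofReal (∑ j ∈ Finset.Icc (-m 0) (m 0), φ (z.1 / h 0 - s 0 - j) ^ 2) *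
          ENNReal.ofReal (∑ j ∈ Finset.Icc (-m 1) (m 1), φ (z.2 / h 1 - s 1 - j) ^ 2)) := by
      intro z hz
      have h1 : uniformDensity M z.2 = 1 / (2 * M) := Set.indicator_of_mem (hA₂M hz.2) _
      rw [h1, ENNReal.ofReal_mul (by positivity), ← ENNReal.ofReal_mul
        (Finset.sum_nonneg fun j _ => sq_nonneg _), Finset.sum_mul_sum, ← Finset.sum_product']
    rw [setLIntegral_congr_fun (hA₁.prod hA₂) hsum, Measure.volume_eq_prod, ← Measure.prod_restrict,
      lintegral_const_mul _ (by fun_prop), lintegral_prod_mul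
        (f := fun x => ENNReal.ofReal (∑ j ∈ Finset.Icc (-m 0) (m 0), φ (x / h 0 - s 0 - j) ^ 2))
        (g := fun y => ENNReal.ofReal (∑ j ∈ Finset.Icc (-m 1) (m 1), φ (y / h 1 - s 1 - j) ^ 2))
        (by fun_prop) (by fun_prop), ENNReal.ofReal_mul (by norm_num), mul_assoc]
  · have : IsProbabilityMeasure (volume.withDensity fun y => ENNReal.ofReal (uniformDensity M y)) :=
      isProbabilityMeasure_uniformLaw hM0
    rw [risk, uniformLaw, chainLaw_mul hfm (uniformDensity_nonneg hM0) (hGm S)]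
    have hlm : Measurable fun x => l2Norm (A₁ ×ˢ A₂) (fun z => est x z - g S z) ^ 2 := by
      simp only [l2Norm_sq]
      exact Measurable.lintegral_prod_right'
        (f := fun q : (Fin (n + 1) → ℝ) × (ℝ × ℝ) => ENNReal.ofReal ((est q.1 q.2 - g S q.2) ^ 2))
        ((hest.sub ((hgm S).comp measurable_snd)).pow_const 2).ennreal_ofReal
    rw [lintegral_withDensity_eq_lintegral_mul _ (hp S) hlm]
    simp only [Pi.mul_apply, l2Norm_sq]

/-! ### The rate and the conclusion -/

/-- Since `1 / α 0 + 1 / α 1 = 2 / ᾱ`, the second equation is `b ^ (2 + 2 / ᾱ) = 1 / n`, solved by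
`b = n ^ (-ᾱ / (2ᾱ + 2))`. -/
lemma exists_rate_exponents (α : Fin 2 → ℝ) (hα : ∀ i, 0 < α i) {n : ℕ} (hn : 1 ≤ n) :
    ∃ b : ℝ, 0 < b ∧ b ≤ 1 ∧
      b ^ 2 = (n : ℝ) ^ (-(2 * harmonicMean α / (2 * harmonicMean α + 2))) ∧
      n * (b ^ 2 * (b ^ (1 / α 0) * b ^ (1 / α 1))) = 1 := by
  set β := harmonicMean α with hβ
  have h0 := hα 0
  have h1 := hα 1
  have hβ0 : 0 < β := by rw [hβ, harmonicMean]; positivity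
  have hn0 : (0 : ℝ) < n := by exact_mod_cast hn
  have hn1 : (1 : ℝ) ≤ n := by exact_mod_cast hn
  have hb : (0 : ℝ) < (n : ℝ) ^ (-(β / (2 * β + 2))) := Real.rpow_pos_of_pos hn0 _
  refine ⟨_, hb, Real.rpow_le_one_of_one_le_of_nonpos hn1 ?_, ?_, ?_⟩
  · have : 0 ≤ β / (2 * β + 2) := by positivity
    linarith
  · rw [← Real.rpow_natCast, ← Real.rpow_mul hn0.le]
    congr 1
    push_cast
    ring
  · have e : 1 / α 0 + 1 / α 1 = 2 / β := by
      rw [hβ, harmonicMean]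
      field_simp
    rw [← Real.rpow_add hb, e, ← Real.rpow_natCast, ← Real.rpow_add hb, ← Real.rpow_mul hn0.le]
    have : -(β / (2 * β + 2)) * (((2 : ℕ) : ℝ) + 2 / β) = -1 := by
      push_cast
      field_simp
    rw [this, Real.rpow_neg_one, mul_inv_cancel₀ hn0.ne']

end MinimaxLowerBound

theorem theorem3 (A₁ A₂ : Set ℝ) (hA₁ : IsCompact A₁) (hA₂ : IsCompact A₂)
    (hA₁pos : 0 < volume A₁) (hA₂pos : 0 < volume A₂)
    (α : Fin 2 → ℝ) (hα : ∀ i, 0 < α i) (r : Fin 2 → ℕ) (hr : ∀ i, α i < r i)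
    (L : ℝ) (hL : 0 < L) :
    ∃ C : ℝ, 0 < C ∧ ∀ᶠ n : ℕ in atTop,
      ENNReal.ofReal (C * (n : ℝ) ^ (-(2 * TransitionDensity.harmonicMean α /
          (2 * TransitionDensity.harmonicMean α + 2)))) ≤
        TransitionDensity.minimaxRisk (A₁ ×ˢ A₂) α r L n := by
  obtain ⟨φ, hφ⟩ := exists_isProfile
  choose B hB using hφ.exists_bound
  have hB0 : ∀ r, 0 ≤ B r := fun r => (abs_nonneg _).trans (hB r 0)
  obtain ⟨R, hR⟩ : ∃ R : ℝ, ∀ x ∈ A₁ ∪ A₂, ‖x‖ ≤ R := (hA₁.union hA₂).isBounded.exists_norm_le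
  have hAR₁ : ∀ ρ, R ≤ ρ → A₁ ⊆ Set.Icc (-ρ) ρ := fun ρ hρ x hx =>
    abs_le.1 ((hR x (Or.inl hx)).trans hρ)
  have hAR₂ : ∀ ρ, R ≤ ρ → A₂ ⊆ Set.Icc (-ρ) ρ := fun ρ hρ x hx =>
    abs_le.1 ((hR x (Or.inr hx)).trans hρ)
  have hR0 : 0 ≤ R := by
    obtain ⟨x, hx⟩ := nonempty_of_measure_ne_zero hA₁pos.ne'
    exact (norm_nonneg _).trans (hR x (Or.inl hx))
  have hA : IsCompact (A₁ ×ˢ A₂) := hA₁.prod hA₂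
  set V : ℝ≥0∞ := volume (A₁ ×ˢ A₂) ^ (1 / 2 : ℝ)
  have hV : V ≠ ∞ := ENNReal.rpow_ne_top_of_nonneg (by norm_num) hA.measure_lt_top.ne
  -- `R + 5` leaves room for every grid cell inside `[-M, M]`; the last term makes the density so
  -- small that the Besov bound `V / M` is at most `L`.
  set M : ℝ := R + 5 + V.toReal / L with hMdef
  have hVL : 0 ≤ V.toReal / L := div_nonneg ENNReal.toReal_nonneg hL.le
  have hM0 : 0 < M := by linarith
  -- Small enough that both `κ` and each `κ * (2 ^ r i + B (r i))` are at most `1/3`.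
  set κ : ℝ := 1 / (3 * (1 + (2 ^ r 0 + B (r 0)) + (2 ^ r 1 + B (r 1)))) with hκ
  have hB0' := hB0 (r 0)
  have hB1' := hB0 (r 1)
  have hκ0 : 0 < κ := by positivity
  have hκ3 : κ ≤ 1 / 3 := by
    rw [hκ]
    refine one_div_le_one_div_of_le (by norm_num) ?_
    have : (0 : ℝ) < 2 ^ r 0 := by positivity
    have : (0 : ℝ) < 2 ^ r 1 := by positivity
    linarith
  have hκB : ∀ i, κ * (2 ^ r i + B (r i)) ≤ 1 / 3 := by
    intro i
    have h0 : (0 : ℝ) < 2 ^ r 0 := by positivity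
    have h1 : (0 : ℝ) < 2 ^ r 1 := by positivity
    rw [hκ, one_div_mul_eq_div, div_le_iff₀ (by positivity)]
    fin_cases i <;> simp only [Fin.zero_eta, Fin.mk_one] <;> linarith
  set v : ℝ := ∫ x, φ x ^ 2
  have hv : 0 < v := hφ.integral_sq_pos
  have hm₁ : volume A₁ ≠ ∞ := hA₁.measure_lt_top.ne
  have hm₂ : volume A₂ ≠ ∞ := hA₂.measure_lt_top.ne
  have hpos₁ := ENNReal.toReal_pos hA₁pos.ne' hm₁
  have hpos₂ := ENNReal.toReal_pos hA₂pos.ne' hm₂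
  refine ⟨1 / 16 * ((1 / (2 * M)) ^ 2 * κ ^ 2) *
    ((v * (volume A₁).toReal) * (v * (volume A₂).toReal)), by positivity, ?_⟩
  filter_upwards [eventually_ge_atTop 1] with n hn
  obtain ⟨b, hb0, hb1, hbn, hnb⟩ := exists_rate_exponents α hα hn
  -- The anisotropic cell sides are chosen so that `h i ^ (-α i) = b⁻¹` in both directions, exactly
  -- offsetting the amplitude `κ * b`.
  set h : Fin 2 → ℝ := fun i => b ^ (1 / α i) with hhdef
  have hh : ∀ i, 0 < h i := fun i => Real.rpow_pos_of_pos hb0 _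
  have hh1 : ∀ i, h i ≤ 1 := fun i =>
    Real.rpow_le_one hb0.le hb1 (one_div_nonneg.2 (hα i).le)
  have hhα : ∀ i, h i ^ (-α i) = b⁻¹ := fun i => by
    rw [hhdef, ← Real.rpow_mul hb0.le, one_div_mul_eq_div, neg_div, div_self (hα i).ne',
      Real.rpow_neg_one]
  set m : Fin 2 → ℤ := fun i => ⌈R / h i⌉ + 2 with hmdef
  have hm : ∀ i, R / h i + 2 ≤ m i := fun i => by
    rw [hmdef]; push_cast; linarith [Int.le_ceil (R / h i)]
  have hmM : ∀ i, h i * (m i + 2) ≤ M := fun i => by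
    have h1 : (m i : ℝ) ≤ R / h i + 3 := by
      rw [hmdef]; push_cast; linarith [Int.ceil_lt_add_one (R / h i)]
    have h2 : h i * (m i + 2) ≤ h i * (R / h i + 5) :=
      mul_le_mul_of_nonneg_left (by linarith) (hh i).le
    have h3 : h i * (R / h i + 5) = R + 5 * h i := by
      have := (hh i).ne'
      field_simp
    linarith [hh1 i]
  obtain ⟨s₁, hs₁, hle₁⟩ := hφ.exists_shift hA₁.measurableSet (hh 0) (hAR₁ R le_rfl) (hm 0)
  obtain ⟨s₂, hs₂, hle₂⟩ := hφ.exists_shift hA₂.measurableSet (hh 1) (hAR₂ R le_rfl) (hm 1)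
  set s : Fin 2 → ℝ := ![s₁, s₂]
  have hs : ∀ i, s i ∈ Set.Icc (0 : ℝ) 1 := by
    intro i; fin_cases i
    · exact hs₁
    · exact hs₂
  have ha0 : 0 ≤ κ * b := by positivity
  have ha3 : κ * b ≤ 1 / 3 := by nlinarith
  have hc1 : (1 / (2 * M)) ^ 2 ≤ 1 / 3 := by
    have h1 : 1 / (2 * M) ≤ 1 / 10 := one_div_le_one_div_of_le (by norm_num) (by linarith)
    have h2 : 0 ≤ 1 / (2 * M) := by positivity
    nlinarith
  -- Information budget: `n b² h₀ h₁ = 1` by the choice of `b`, and the remaining constants are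
  -- small because `κ ≤ 1/3` and `M ≥ 5`.
  have hn3 : n * ((κ * b) ^ 2 * ((1 / (2 * M)) ^ 2 * (h 0 * h 1))) ≤ 1 / 3 := by
    have e : n * ((κ * b) ^ 2 * ((1 / (2 * M)) ^ 2 * (h 0 * h 1))) =
        κ ^ 2 * (1 / (2 * M)) ^ 2 * (n * (b ^ 2 * (h 0 * h 1))) := by ring
    rw [e, hnb, mul_one]
    have : κ ^ 2 ≤ 1 := by nlinarith
    calc κ ^ 2 * (1 / (2 * M)) ^ 2 ≤ 1 * (1 / 3) := by gcongr
      _ = 1 / 3 := one_mul _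
  refine le_iInf₂ fun est hest => ?_
  obtain ⟨S, hS, hrisk⟩ := hφ.exists_le_risk hM0 hh hs hmM ha0 ha3 hn3 hA₁.measurableSet
    hA₂.measurableSet (hAR₂ M (by linarith)) est hest
  have : IsProbabilityMeasure (volume.withDensity fun y => ENNReal.ofReal (uniformDensity M y)) :=
    isProbabilityMeasure_uniformLaw hM0
  have hD := hφ.isCouplingDensity hM0 hh hs hmM hS ha0 ha3
  have hwm : Measurable fun z => κ * b * gridBump φ h s S z :=
    (hφ.measurable_gridBump h s S).const_mul _
  have hwb : ∀ z, |κ * b * gridBump φ h s S z| ≤ 1 / 3 := fun z => by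
    rw [abs_mul, abs_of_nonneg ha0]
    nlinarith [hφ.abs_gridBump_le h s S z, abs_nonneg (gridBump φ h s S z)]
  have hfm := measurable_uniformDensity M
  have hf0 := uniformDensity_nonneg hM0
  have hrec := isPositiveRecurrent_mul hfm hf0 hwm hwb hD
  have hbesov := hφ.besovNorm_le hA.isClosed (f := uniformDensity M) (c := 1 / (2 * M))
    (by positivity) (fun z hz => Set.indicator_of_mem (hAR₂ M (by linarith) hz.2) _) h s hh S α hα
    r hr (fun i => hB (r i)) ha0 ha3 fun i => by
      rw [hhα]
      have : κ * b * ((2 ^ r i + B (r i)) * b⁻¹) = κ * (2 ^ r i + B (r i)) := by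
        field_simp
      rw [this]
      exact hκB i
  have hclass : (fun z => uniformDensity M z.2 * (1 + κ * b * gridBump φ h s S z)) ∈
      TransitionDensity.besovClass (A₁ ×ˢ A₂) α r L := by
    refine ⟨isTransitionDensity_mul hfm hf0 hwm hwb hD, ⟨_, hrec⟩, hbesov.trans ?_⟩
    change V * _ ≤ _
    rw [← ENNReal.ofReal_toReal hV, ← ENNReal.ofReal_mul ENNReal.toReal_nonneg]
    refine ENNReal.ofReal_le_ofReal ?_
    have h1 : V.toReal * (2 * (1 / (2 * M))) = V.toReal / M := by field_simp
    rw [h1, div_le_iff₀ hM0]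
    have h2 : L * (V.toReal / L) = V.toReal := by field_simp
    nlinarith
  refine le_trans ?_ (le_iSup₂_of_le _ hclass (le_iSup₂_of_le _ hrec hrisk))
  calc _ = ENNReal.ofReal (1 / 16 * ((1 / (2 * M)) ^ 2 * (κ * b) ^ 2)) *
        ((ENNReal.ofReal v * volume A₁) * (ENNReal.ofReal v * volume A₂)) := by
        rw [← hbn, ← ENNReal.ofReal_toReal hm₁, ← ENNReal.ofReal_toReal hm₂,
          ← ENNReal.ofReal_mul hv.le, ← ENNReal.ofReal_mul hv.le,
          ← ENNReal.ofReal_mul (by positivity), ← ENNReal.ofReal_mul (by positivity),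
          ENNReal.toReal_ofReal ENNReal.toReal_nonneg, ENNReal.toReal_ofReal ENNReal.toReal_nonneg]
        congr 1
        ring
    _ ≤ _ := by
        gcongr
        · exact hle₁
        · exact hle₂
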